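/- Let $s\ge 0$ and $n\ge 1$ be integers. Let $\mathrm{Sym}(\mathbb R^n)$ be the symmetric algebra of $\mathbb R^n$ with the inner product for which the monomials $e^a$ in the standard basis are orthogonal with $\|e^a\|^2=a!$, and let $\sigma_*$ be the isometry of $\mathrm{Sym}(\mathbb R^n)$ induced by $e_i\mapsto e_{\sigma(i)}$, for $\sigma\in\Sigma_n$. Let $S^n$ be the one-point compactification of $\mathbb R^n$, with basepoint $\infty$ and with $\Sigma_n$ permuting coordinates, $(\sigma x)_i=x_{\sigma^{-1}(i)}$. Let $$ko_n=\int^{\langle k\rangle} ko(\langle k\rangle,\mathrm{Sym}(\mathbb R^n))\times \mathrm{Map}_*(\langle k\rangle,S^n)$$ (coend over finite pointed sets), where $ko(\langle k\rangle,\mathcal U)=\bigsqcup_{m_1,\dots,m_k\ge 0}L(\mathbb R^{m_1}\oplus\dots\oplus\mathbb R^{m_k},\mathcal U)/(O(m_1)\times\dots\times O(m_k))$ is the space of $k$-tuples of mutually orthogonal finite dimensional subspaces of $\mathcal U$, which is covariantly functorial in $\langle k\rangle$ by taking direct sums of subspaces. Here $L(V,W)$ is the space of linear isometric embeddings $V\to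 W$, with the colimit topology over the Stiefel manifolds $L(V,W')$ for the finite dimensional subspaces $W'\subseteq W$. Points of $ko_n$ are configurations $[(V_1,x_1),\dots,(V_k,x_k)]$ of points $x_i\in S^n$ with orthogonal labels $V_i$, and $\sigma\in\Sigma_n$ sends such a configuration to $[(\sigma_*V_1,\sigma x_1),\dots,(\sigma_*V_k,\sigma x_k)]$. For an integer $r\ge -1$ let $R^r(ko_n)\subseteq ko_n$ be the subspace of the configurations with $\sum_{x_i\ne\infty}\dim_{\mathbb R} V_i\le r$. Let $C_n(\mathfrak{sym}_s)$ be the space of $n$-tuples of pairwise commuting real symmetric $s\times s$ matrices, on which $O(s)$ acts by simultaneous conjugation, and let $C_n(\mathfrak{sym}_s)^+$ be its one-point compactification. Let $C_n(\mathfrak{sym}_s)^+\wedge_{O(s)}L(\mathbb R^s,\mathrm{Sym}(\mathbb R^n))_+$ be the quotient of the smash product by the relation $X\wedge (f\circ g)\sim (gXg^{-1})\wedge f$ for $g\in O(s)$, with the $\Sigma_n$-action $$\sigma\cdot[(X_1,\dots,X_n)\wedge f]=[(X_{\sigma^{-1}(1)},\dots,X_{\sigma^{-1}(n)})\wedge(\sigma_*\circ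 f)].$$ **Theorem.** There is a $\Sigma_n$-equivariant based homeomorphism $$R^s(ko_n)/R^{s-1}(ko_n)\;\cong\; C_n(\mathfrak{sym}_s)^+\wedge_{O(s)}L(\mathbb R^s,\mathrm{Sym}(\mathbb R^n))_+,$$ where, for $s=0$, the quotient by $R^{-1}(ko_n)=\emptyset$ is $R^0(ko_n)$ with a disjoint basepoint added. -/

import Mathlib

open scoped OnePoint

noncomputable section

namespace KO

/-! ### Spaces of linear isometric embeddings -/

section Stiefel

variable (V W : Type*) [NormedAddCommGroup V] [InnerProductSpace ℝ V]
  [NormedAddCommGroup W] [InnerProductSpace ℝ W]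

/-- The topology of the Stiefel manifold on the set of linear isometric embeddings `V → W`
(`V`, `W` finite dimensional): the subspace topology from the normed space of linear maps. -/
@[reducible]
def stiefelTopology : TopologicalSpace (V →ₗᵢ[ℝ] W) :=
  TopologicalSpace.induced LinearIsometry.toContinuousLinearMap inferInstance

/-- The space `L(V, W)` of linear isometric embeddings of a finite dimensional `V` into an inner
product space `W` of arbitrary dimension. -/
def L : Type _ := V →ₗᵢ[ℝ] W

/-- `L(V, W)` is the colimit of the Stiefel manifolds `L(V, W')` over the finite dimensional
subspaces `W'` of `W`: it carries the finest topology that makes all the maps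
`L(V, W') → L(V, W)` continuous. -/
instance : TopologicalSpace (L V W) :=
  ⨆ W' : {W' : Submodule ℝ W // FiniteDimensional ℝ W'},
    TopologicalSpace.coinduced
      (fun f : V →ₗᵢ[ℝ] W'.1 ↦ (W'.1.subtypeₗᵢ.comp f : V →ₗᵢ[ℝ] W)) (stiefelTopology V W'.1)

end Stiefel

/-! ### The `Γ`-space `ko(-, U)` and its extension to pointed spaces -/

section Gamma

variable (U : Type*) [NormedAddCommGroup U] [InnerProductSpace ℝ U]

/-- `ko(⟨k⟩, U)` as a set: `k`-tuples of mutually orthogonal finite dimensional subspaces. -/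
@[ext]
structure OrthTuple (k : ℕ) where
  space : Fin k → Submodule ℝ U
  finite : ∀ i, FiniteDimensional ℝ (space i)
  orth : Pairwise fun i j ↦ space i ⟂ space j

/-- The summand `ℝ^(m i)` of `ℝ^(m 1) ⊕ ⋯ ⊕ ℝ^(m k)`. -/
def block {k : ℕ} (m : Fin k → ℕ) (i : Fin k) :
    Submodule ℝ (EuclideanSpace ℝ (Σ i, Fin (m i))) where
  carrier := {x | ∀ p, p.1 ≠ i → x p = 0}
  add_mem' hx hy p hp := by simp [hx p hp, hy p hp]
  zero_mem' p _ := by simp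
  smul_mem' c x hx p hp := by simp [hx p hp]

lemma block_orth {k : ℕ} (m : Fin k → ℕ) {i j : Fin k} (h : i ≠ j) : block m i ⟂ block m j := by
  rw [Submodule.isOrtho_iff_inner_eq]
  intro x hx y hy
  rw [PiLp.inner_apply]
  refine Finset.sum_eq_zero fun p _ ↦ ?_
  by_cases hp : p.1 = i
  · rw [hy p (by rw [hp]; exact h), inner_zero_right]
  · rw [hx p hp, inner_zero_left]

variable {U} in
/-- The tuple of subspaces `(f(ℝ^(m 1)), …, f(ℝ^(m k)))` that is spanned by an isometric embedding
`f : ℝ^(m 1) ⊕ ⋯ ⊕ ℝ^(m k) → U`. -/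
def OrthTuple.ofFrame {k : ℕ} (m : Fin k → ℕ)
    (f : EuclideanSpace ℝ (Σ i, Fin (m i)) →ₗᵢ[ℝ] U) : OrthTuple U k where
  space i := (block m i).map f.toLinearMap
  finite _ := inferInstance
  orth _ _ h := (block_orth m h).map f

/-- The topology of `ko(⟨k⟩, U) = ⨆_m L(ℝ^(m 1) ⊕ ⋯ ⊕ ℝ^(m k), U) / (O(m 1) × ⋯ × O(m k))`
(disjoint union over `m`). Two embeddings are in the same orbit if and only if they span the same
tuple of subspaces, and every tuple arises, so this is the quotient topology along `ofFrame`. -/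
instance (k : ℕ) : TopologicalSpace (OrthTuple U k) :=
  TopologicalSpace.coinduced
    (fun p : Σ m : Fin k → ℕ, L (EuclideanSpace ℝ (Σ i, Fin (m i))) U ↦
      OrthTuple.ofFrame p.1 p.2) inferInstance

variable {U}

/-- Functoriality of `ko(-, U)`. A based map `⟨k⟩ → ⟨l⟩` is given by its values
`α : Fin k → Option (Fin l)` off the basepoint, with `none` for the basepoint of `⟨l⟩`; the
tuple `V` is sent to `W` with `W i = ⨁_{α j = i} V j`. -/
def OrthTuple.push {k l : ℕ} (α : Fin k → Option (Fin l)) (V : OrthTuple U k) : OrthTuple U l where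
  space i := ⨆ j : {j // α j = some i}, V.space j
  finite i := by
    have := V.finite
    infer_instance
  orth i i' h := by
    simp only [Submodule.isOrtho_iSup_left, Submodule.isOrtho_iSup_right]
    rintro ⟨j, hj⟩ ⟨j', hj'⟩
    refine V.orth ?_
    rintro rfl
    exact h (Option.some.inj (hj'.symm.trans hj))

/-- The composite `⟨k⟩ → ⟨l⟩ → X` of based maps, where `pt` is the basepoint of `X`. -/
def pullPoints {X : Type*} (pt : X) {k l : ℕ} (α : Fin k → Option (Fin l)) (x : Fin l → X) :
    Fin k → X :=
  fun j ↦ (α j).elim pt x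

variable (U)

/-- The identifications in the coend: `(α_* V, x) ∼ (V, α^* x)` for every based map
`α : ⟨k⟩ → ⟨l⟩`. -/
inductive CoendRel {X : Type*} (pt : X) :
    (Σ k : ℕ, OrthTuple U k × (Fin k → X)) → (Σ k : ℕ, OrthTuple U k × (Fin k → X)) → Prop
  | glue {k l : ℕ} (α : Fin k → Option (Fin l)) (V : OrthTuple U k) (x : Fin l → X) :
      CoendRel pt ⟨l, V.push α, x⟩ ⟨k, V, pullPoints pt α x⟩

/-- The space `ko(X, U) = ∫^⟨k⟩ ko(⟨k⟩, U) × Map_*(⟨k⟩, X)` of configurations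
`[(V 1, x 1), …, (V k, x k)]` of points of the pointed space `(X, pt)` with orthogonal labels. -/
def Conf {X : Type*} (pt : X) : Type _ := Quot (CoendRel U pt)

instance {X : Type*} [TopologicalSpace X] (pt : X) : TopologicalSpace (Conf U pt) :=
  inferInstanceAs (TopologicalSpace (Quot (CoendRel U pt)))

variable {U}

/-- The configuration `[(V 1, x 1), …, (V k, x k)]`. -/
def Conf.mk {X : Type*} (pt : X) {k : ℕ} (V : OrthTuple U k) (x : Fin k → X) : Conf U pt :=
  Quot.mk _ ⟨k, V, x⟩

/-- The image of a tuple of subspaces under a linear isometric embedding. -/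
def OrthTuple.map {k : ℕ} (φ : U →ₗᵢ[ℝ] U) (V : OrthTuple U k) : OrthTuple U k where
  space i := (V.space i).map φ.toLinearMap
  finite i := by
    have := V.finite i
    infer_instance
  orth _ _ h := (V.orth h).map φ

/-- The self-map `[(V i, x i)] ↦ [(φ (V i), h (x i))]` for a based map `h`. -/
def Conf.map {X : Type*} {pt : X} (φ : U →ₗᵢ[ℝ] U) (h : X → X) (hpt : h pt = pt) :
    Conf U pt → Conf U pt :=
  Quot.map (fun p ↦ ⟨p.1, p.2.1.map φ, h ∘ p.2.2⟩) (by
    rintro _ _ ⟨α, V, x⟩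
    have h1 : (V.push α).map φ = (V.map φ).push α := by
      ext1
      funext i
      simp only [OrthTuple.map, OrthTuple.push, Submodule.map_iSup]
    have h2 : h ∘ pullPoints pt α x = pullPoints pt α (h ∘ x) := by
      funext j
      simp only [Function.comp, pullPoints]
      cases α j <;> simp [hpt]
    rw [h1, h2]
    exact CoendRel.glue α _ _)

open Classical in
variable (U) in
/-- The rank filtration: `R^s` is the set of all configurations `[(V 1, x 1), …, (V k, x k)]` with
`∑ dim V i ≤ s`, the sum being over those `i` for which `x i` is not the basepoint. -/
def rankFiltration {X : Type*} (pt : X) (s : ℤ) : Set (Conf U pt) :=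
  {z | ∃ (k : ℕ) (V : OrthTuple U k) (x : Fin k → X), z = Conf.mk pt V x ∧
    ((∑ i with x i ≠ pt, Module.finrank ℝ (V.space i) : ℕ) : ℤ) ≤ s}

lemma map_mem_rankFiltration {X : Type*} {pt : X} (φ : U →ₗᵢ[ℝ] U) (h : X → X) (hpt : h pt = pt)
    (hinj : Function.Injective h) {s : ℤ} {z : Conf U pt} (hz : z ∈ rankFiltration U pt s) :
    Conf.map φ h hpt z ∈ rankFiltration U pt s := by
  obtain ⟨k, V, x, rfl, hs⟩ := hz
  refine ⟨k, V.map φ, h ∘ x, rfl, le_of_eq_of_le ?_ hs⟩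
  congr 1
  refine Finset.sum_congr ?_ fun i _ ↦ ?_
  · ext i
    simp only [Finset.mem_filter, Finset.mem_univ, true_and, Function.comp, ne_eq]
    rw [← hinj.eq_iff (a := x i), hpt]
  · exact (Submodule.equivMapOfInjective φ.toLinearMap φ.injective (V.space i)).finrank_eq.symm

end Gamma

/-! ### The symmetric algebra of `ℝ^n` as an inner product space -/

section Sym

open MvPolynomial

/-- The inner product of two polynomials, for which the monomials are orthogonal and
`X^a` has squared norm `a! = ∏ (a i)!`. -/
def polyInner {n : ℕ} (p q : MvPolynomial (Fin n) ℝ) : ℝ :=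
  ∑ a ∈ p.support, (∏ i, ((a i).factorial : ℝ)) * p.coeff a * q.coeff a

lemma polyInner_eq_left {n : ℕ} (p q : MvPolynomial (Fin n) ℝ) (S : Finset (Fin n →₀ ℕ))
    (hS : p.support ⊆ S) :
    polyInner p q = ∑ a ∈ S, (∏ i, ((a i).factorial : ℝ)) * p.coeff a * q.coeff a := by
  refine Finset.sum_subset hS fun a _ ha ↦ ?_
  rw [notMem_support_iff.1 ha]
  ring

/-- The symmetric algebra `Sym(ℝ^n)`. -/
def SymSpace (n : ℕ) : Type := SymmetricAlgebra ℝ (EuclideanSpace ℝ (Fin n))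

instance (n : ℕ) : CommRing (SymSpace n) :=
  inferInstanceAs (CommRing (SymmetricAlgebra ℝ (EuclideanSpace ℝ (Fin n))))

instance (n : ℕ) : Algebra ℝ (SymSpace n) :=
  inferInstanceAs (Algebra ℝ (SymmetricAlgebra ℝ (EuclideanSpace ℝ (Fin n))))

/-- The inclusion `ℝ^n → Sym(ℝ^n)` of the linear summand. -/
def SymSpace.incl (n : ℕ) : EuclideanSpace ℝ (Fin n) →ₗ[ℝ] SymSpace n :=
  SymmetricAlgebra.ι ℝ (EuclideanSpace ℝ (Fin n))

/-- Elements of `Sym(ℝ^n)` written as polynomials in the standard basis of `ℝ^n`. -/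
def SymSpace.toPoly (n : ℕ) : SymSpace n ≃ₐ[ℝ] MvPolynomial (Fin n) ℝ :=
  SymmetricAlgebra.equivMvPolynomial (EuclideanSpace.basisFun (Fin n) ℝ).toBasis

/-- The preferred inner product on `Sym(ℝ^n)`: monomials in the standard basis are orthogonal and
`e^a` has squared norm `a!`. Equivalently, the homogeneous summands are orthogonal and
`⟨v₁ ⋯ v_k, w₁ ⋯ w_k⟩ = ∑_σ ∏_i ⟨v_i, w_(σ i)⟩`, the sum being over all permutations. -/
@[reducible]
def SymSpace.core (n : ℕ) : InnerProductSpace.Core ℝ (SymSpace n) where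
  inner p q := polyInner (SymSpace.toPoly n p) (SymSpace.toPoly n q)
  conj_inner_symm p q := by
    simp only [conj_trivial]
    classical
    rw [polyInner_eq_left _ _ _ (Finset.subset_union_left (s₂ := (SymSpace.toPoly n p).support)),
      polyInner_eq_left _ _ _ (Finset.subset_union_right (s₁ := (SymSpace.toPoly n q).support))]
    exact Finset.sum_congr rfl fun a _ ↦ by ring
  re_inner_nonneg p := by
    simp only [RCLike.re_to_real]
    refine Finset.sum_nonneg fun a _ ↦ ?_
    rw [mul_assoc]
    exact mul_nonneg (by positivity) (mul_self_nonneg _)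
  add_left p q r := by
    classical
    rw [map_add, polyInner_eq_left _ _ _ support_add,
      polyInner_eq_left _ _ _ (Finset.subset_union_left (s₂ := (SymSpace.toPoly n q).support)),
      polyInner_eq_left _ _ _ (Finset.subset_union_right (s₁ := (SymSpace.toPoly n p).support)),
      ← Finset.sum_add_distrib]
    exact Finset.sum_congr rfl fun a _ ↦ by rw [coeff_add]; ring
  smul_left p q c := by
    simp only [conj_trivial]
    rw [map_smul, polyInner_eq_left _ _ _ support_smul, polyInner, Finset.mul_sum]
    exact Finset.sum_congr rfl fun a _ ↦ by rw [coeff_smul, smul_eq_mul]; ring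
  definite p h := by
    have h0 : ∀ a ∈ (SymSpace.toPoly n p).support,
        (∏ i, ((a i).factorial : ℝ)) * (SymSpace.toPoly n p).coeff a
          * (SymSpace.toPoly n p).coeff a = 0 := by
      refine (Finset.sum_eq_zero_iff_of_nonneg fun a _ ↦ ?_).1 h
      rw [mul_assoc]
      exact mul_nonneg (by positivity) (mul_self_nonneg _)
    have h1 : SymSpace.toPoly n p = 0 := by
      rw [← support_eq_empty, Finset.eq_empty_iff_forall_notMem]
      intro a ha
      have hf : (∏ i, ((a i).factorial : ℝ)) ≠ 0 :=
        Finset.prod_ne_zero_iff.2 fun i _ ↦ by positivity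
      have := h0 a ha
      rw [mul_assoc, mul_eq_zero, mul_self_eq_zero] at this
      exact (mem_support_iff.1 ha) (this.resolve_left hf)
    exact (map_eq_zero_iff _ (SymSpace.toPoly n).injective).1 h1

instance (n : ℕ) : NormedAddCommGroup (SymSpace n) := (SymSpace.core n).toNormedAddCommGroup

instance (n : ℕ) : InnerProductSpace ℝ (SymSpace n) :=
  InnerProductSpace.ofCore (SymSpace.core n).toCore

/-- The standard action of `σ ∈ Σ_n` on `ℝ^n`, with `σ e_i = e_(σ i)`, i.e.
`(σ x) i = x (σ⁻¹ i)`. -/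
def coordPerm {n : ℕ} (σ : Equiv.Perm (Fin n)) :
    EuclideanSpace ℝ (Fin n) ≃ₗᵢ[ℝ] EuclideanSpace ℝ (Fin n) :=
  LinearIsometryEquiv.piLpCongrLeft 2 ℝ ℝ σ

lemma coordPerm_apply {n : ℕ} (σ : Equiv.Perm (Fin n)) (x : EuclideanSpace ℝ (Fin n))
    (i : Fin n) : coordPerm σ x i = x (σ⁻¹ i) := by
  rfl

/-- The algebra automorphism of `Sym(ℝ^n)` induced by the action of `σ` on `ℝ^n`. -/
def SymSpace.permHom {n : ℕ} (σ : Equiv.Perm (Fin n)) : SymSpace n →ₐ[ℝ] SymSpace n :=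
  SymmetricAlgebra.lift (SymSpace.incl n ∘ₗ (coordPerm σ).toLinearEquiv.toLinearMap)

lemma SymSpace.permHom_incl {n : ℕ} (σ : Equiv.Perm (Fin n)) (x : EuclideanSpace ℝ (Fin n)) :
    SymSpace.permHom σ (SymSpace.incl n x) = SymSpace.incl n (coordPerm σ x) :=
  SymmetricAlgebra.lift_ι_apply _ x

lemma SymSpace.hom_ext {n : ℕ} {F G : SymSpace n →ₐ[ℝ] SymSpace n}
    (h : ∀ x, F (SymSpace.incl n x) = G (SymSpace.incl n x)) : F = G :=
  SymmetricAlgebra.algHom_ext (LinearMap.ext h)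

lemma SymSpace.permHom_one (n : ℕ) : SymSpace.permHom (1 : Equiv.Perm (Fin n)) = .id ℝ _ :=
  SymSpace.hom_ext fun x ↦ by
    rw [SymSpace.permHom_incl]
    rfl

lemma SymSpace.permHom_mul {n : ℕ} (σ τ : Equiv.Perm (Fin n)) :
    SymSpace.permHom (σ * τ) = (SymSpace.permHom σ).comp (SymSpace.permHom τ) :=
  SymSpace.hom_ext fun x ↦ by
    rw [AlgHom.comp_apply, SymSpace.permHom_incl, SymSpace.permHom_incl, SymSpace.permHom_incl]
    rfl

lemma SymSpace.toPoly_permHom {n : ℕ} (σ : Equiv.Perm (Fin n)) (p : SymSpace n) :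
    SymSpace.toPoly n (SymSpace.permHom σ p) = rename σ (SymSpace.toPoly n p) := by
  have hX : ∀ i : Fin n, SymSpace.toPoly n
      (SymSpace.incl n ((EuclideanSpace.basisFun (Fin n) ℝ).toBasis i)) = X i := fun i ↦
    SymmetricAlgebra.equivMvPolynomial_ι_apply (EuclideanSpace.basisFun (Fin n) ℝ).toBasis i
  have hσ : ∀ i : Fin n, coordPerm σ ((EuclideanSpace.basisFun (Fin n) ℝ).toBasis i) =
      (EuclideanSpace.basisFun (Fin n) ℝ).toBasis (σ i) := fun i ↦ by
    ext j
    rw [coordPerm_apply]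
    simp [Equiv.Perm.inv_def, Equiv.symm_apply_eq]
  have h : ((SymSpace.toPoly n : SymSpace n →ₐ[ℝ] MvPolynomial (Fin n) ℝ).comp
      (SymSpace.permHom σ)) = (rename σ).comp (SymSpace.toPoly n : SymSpace n →ₐ[ℝ] _) := by
    refine SymmetricAlgebra.algHom_ext
      ((EuclideanSpace.basisFun (Fin n) ℝ).toBasis.ext fun i ↦ ?_)
    change SymSpace.toPoly n (SymSpace.permHom σ (SymSpace.incl n _)) =
      rename σ (SymSpace.toPoly n (SymSpace.incl n _))
    rw [SymSpace.permHom_incl, hσ, hX, hX, rename_X]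
  exact DFunLike.congr_fun h p

lemma polyInner_rename {n : ℕ} (σ : Equiv.Perm (Fin n)) (p q : MvPolynomial (Fin n) ℝ) :
    polyInner (rename σ p) (rename σ q) = polyInner p q := by
  classical
  unfold polyInner
  rw [support_rename_of_injective σ.injective,
    Finset.sum_image (Finsupp.mapDomain_injective σ.injective).injOn]
  refine Finset.sum_congr rfl fun a _ ↦ ?_
  rw [coeff_rename_mapDomain _ σ.injective, coeff_rename_mapDomain _ σ.injective]
  congr 2
  rw [← Equiv.prod_comp σ]
  exact Finset.prod_congr rfl fun i _ ↦ by rw [Finsupp.mapDomain_apply σ.injective]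

/-- The isometry `σ_*` of `Sym(ℝ^n)` induced by `σ ∈ Σ_n`. -/
def SymSpace.perm {n : ℕ} (σ : Equiv.Perm (Fin n)) : SymSpace n →ₗᵢ[ℝ] SymSpace n :=
  (SymSpace.permHom σ).toLinearMap.isometryOfInner fun p q ↦ by
    change polyInner (SymSpace.toPoly n (SymSpace.permHom σ p))
      (SymSpace.toPoly n (SymSpace.permHom σ q)) = polyInner _ _
    rw [SymSpace.toPoly_permHom, SymSpace.toPoly_permHom, polyInner_rename]

lemma SymSpace.perm_one (n : ℕ) : SymSpace.perm (1 : Equiv.Perm (Fin n)) = .id :=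
  LinearIsometry.ext fun p ↦ DFunLike.congr_fun (SymSpace.permHom_one n) p

lemma SymSpace.perm_mul {n : ℕ} (σ τ : Equiv.Perm (Fin n)) :
    SymSpace.perm (σ * τ) = (SymSpace.perm σ).comp (SymSpace.perm τ) :=
  LinearIsometry.ext fun p ↦ DFunLike.congr_fun (SymSpace.permHom_mul σ τ) p

end Sym

/-! ### The spaces `ko_n`, the rank filtration and its subquotients -/

section Filtration

/-- The sphere `S^n`, the one-point compactification of `ℝ^n`, with basepoint `∞`. -/
abbrev Sphere (n : ℕ) : Type := OnePoint (EuclideanSpace ℝ (Fin n))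

/-- The `n`-th space `ko_n = ko(S^n, Sym(ℝ^n))` of the symmetric spectrum `ko`. -/
abbrev Space (n : ℕ) : Type := Conf (SymSpace n) (∞ : Sphere n)

/-- The action of `Σ_n` on `ko_n`: `σ [(V i, x i)] = [(σ_* (V i), σ x i)]`. -/
instance (n : ℕ) : MulAction (Equiv.Perm (Fin n)) (Space n) where
  smul σ := Conf.map (SymSpace.perm σ) (OnePoint.map (coordPerm σ)) (OnePoint.map_infty _)
  one_smul z := by
    obtain ⟨k, V, x⟩ := z
    change Conf.mk ∞ (V.map _) (OnePoint.map _ ∘ x) = Conf.mk ∞ V x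
    have h1 : V.map (SymSpace.perm 1) = V := by
      ext1
      funext i
      rw [SymSpace.perm_one]
      exact Submodule.map_id _
    have h2 : (coordPerm (1 : Equiv.Perm (Fin n)) : EuclideanSpace ℝ (Fin n) → _) = id := rfl
    rw [h1, h2, OnePoint.map_id, Function.id_comp]
  mul_smul σ τ z := by
    obtain ⟨k, V, x⟩ := z
    change Conf.mk ∞ (V.map _) (OnePoint.map _ ∘ x) =
      Conf.mk ∞ ((V.map _).map _) (OnePoint.map _ ∘ OnePoint.map _ ∘ x)
    have h1 : V.map (SymSpace.perm (σ * τ)) =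
        (V.map (SymSpace.perm τ)).map (SymSpace.perm σ) := by
      ext1
      funext i
      rw [SymSpace.perm_mul]
      exact Submodule.map_comp _ _ _
    have h2 : (coordPerm (σ * τ) : EuclideanSpace ℝ (Fin n) → _) =
        coordPerm σ ∘ coordPerm τ := rfl
    rw [h1, h2, OnePoint.map_comp, Function.comp_assoc]

/-- The subspace `R^s(ko_n)` of `ko_n`, for an integer `s`. -/
abbrev R (s : ℤ) (n : ℕ) : Set (Space n) := rankFiltration (SymSpace n) (∞ : Sphere n) s

lemma Space.smul_def {n : ℕ} (σ : Equiv.Perm (Fin n)) (z : Space n) :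
    σ • z = Conf.map (SymSpace.perm σ) (OnePoint.map (coordPerm σ)) (OnePoint.map_infty _) z := rfl

lemma sphere_injective {n : ℕ} (σ : Equiv.Perm (Fin n)) :
    Function.Injective (OnePoint.map (coordPerm σ) : Sphere n → Sphere n) :=
  Option.map_injective (coordPerm σ).injective

lemma smul_mem_R {s : ℤ} {n : ℕ} (σ : Equiv.Perm (Fin n)) {z : Space n} (hz : z ∈ R s n) :
    σ • z ∈ R s n := by
  rw [Space.smul_def]
  exact map_mem_rankFiltration _ _ _ (sphere_injective σ) hz

/-- The identifications `b ∼ pt` (`b ∈ B`) on the disjoint union of `A` and a point. -/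
inductive CollapseRel {X : Type*} (A B : Set X) : A ⊕ Unit → A ⊕ Unit → Prop
  | collapse (a : A) (ha : a.1 ∈ B) : CollapseRel A B (Sum.inl a) (Sum.inr ())

/-- The quotient space `A / B` for subspaces `B ⊆ A` of `X`, i.e. the pushout of `A ← B → pt`; as
usual, `A / ∅` is `A` together with a disjoint basepoint. -/
def Collapse {X : Type*} (A B : Set X) : Type _ := Quot (CollapseRel A B)

instance {X : Type*} [TopologicalSpace X] (A B : Set X) : TopologicalSpace (Collapse A B) :=
  inferInstanceAs (TopologicalSpace (Quot (CollapseRel A B)))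

/-- The subquotient `R^s(ko_n) / R^(s-1)(ko_n)`. -/
abbrev Subquotient (s n : ℕ) : Type := Collapse (R (s : ℤ) n) (R ((s : ℤ) - 1) n)

/-- The basepoint of `R^s(ko_n) / R^(s-1)(ko_n)`. -/
def Subquotient.base (s n : ℕ) : Subquotient s n := Quot.mk _ (Sum.inr ())

/-- The action of `Σ_n` on `ko_n` restricted to `R^s(ko_n)`. -/
def permR {s : ℤ} {n : ℕ} (σ : Equiv.Perm (Fin n)) (z : R s n) : R s n :=
  ⟨σ • z.1, smul_mem_R σ z.2⟩

lemma permR_one {s : ℤ} {n : ℕ} (z : R s n) : permR 1 z = z := Subtype.ext (one_smul _ z.1)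

lemma permR_mul {s : ℤ} {n : ℕ} (σ τ : Equiv.Perm (Fin n)) (z : R s n) :
    permR (σ * τ) z = permR σ (permR τ z) := Subtype.ext (mul_smul σ τ z.1)

/-- The self-map of `R^s(ko_n) / R^(s-1)(ko_n)` induced by the action of `σ ∈ Σ_n` on `ko_n`. -/
def Subquotient.perm {s n : ℕ} (σ : Equiv.Perm (Fin n)) : Subquotient s n → Subquotient s n :=
  Quot.map (Sum.map (permR σ) id) (by
    rintro _ _ ⟨a, ha⟩
    exact CollapseRel.collapse _ (smul_mem_R σ ha))

/-- The class of a point of `R^s(ko_n)` in `R^s(ko_n) / R^(s-1)(ko_n)`. -/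
def Subquotient.mk {s n : ℕ} (z : R (s : ℤ) n) : Subquotient s n := Quot.mk _ (Sum.inl z)

lemma Subquotient.cases {s n : ℕ} {P : Subquotient s n → Prop} (hbase : P (Subquotient.base s n))
    (hmk : ∀ z, P (Subquotient.mk z)) (z : Subquotient s n) : P z :=
  Quot.ind (fun w ↦ Sum.casesOn w hmk fun _ ↦ hbase) z

lemma Subquotient.perm_base {s n : ℕ} (σ : Equiv.Perm (Fin n)) :
    Subquotient.perm σ (Subquotient.base s n) = Subquotient.base s n := rfl

lemma Subquotient.perm_mk {s n : ℕ} (σ : Equiv.Perm (Fin n)) (z : R (s : ℤ) n) :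
    Subquotient.perm σ (Subquotient.mk z) = Subquotient.mk (permR σ z) := rfl

lemma Subquotient.perm_one {s n : ℕ} (z : Subquotient s n) : Subquotient.perm 1 z = z := by
  induction z using Subquotient.cases with
  | hbase => rw [Subquotient.perm_base]
  | hmk z => rw [Subquotient.perm_mk, permR_one]

lemma Subquotient.perm_mul {s n : ℕ} (σ τ : Equiv.Perm (Fin n)) (z : Subquotient s n) :
    Subquotient.perm (σ * τ) z = Subquotient.perm σ (Subquotient.perm τ z) := by
  induction z using Subquotient.cases with
  | hbase => simp only [Subquotient.perm_base]
  | hmk z => simp only [Subquotient.perm_mk, permR_mul]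

/-- The action of `Σ_n` on `R^s(ko_n) / R^(s-1)(ko_n)`. -/
instance (s n : ℕ) : MulAction (Equiv.Perm (Fin n)) (Subquotient s n) where
  smul := Subquotient.perm
  one_smul := Subquotient.perm_one
  mul_smul := Subquotient.perm_mul

end Filtration

/-! ### Commuting symmetric matrices and the half-smash product -/

section Commuting

/-- The space `C_n(𝔰𝔶𝔪_s)` of `n`-tuples of pairwise commuting real symmetric `s × s` matrices, with
the Euclidean topology. -/
abbrev CommSym (n s : ℕ) : Type :=
  {X : Fin n → Matrix (Fin s) (Fin s) ℝ // (∀ i, (X i).IsSymm) ∧ ∀ i j, Commute (X i) (X j)}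

/-- The action of `g ∈ O(s)` on `C_n(𝔰𝔶𝔪_s)` by simultaneous conjugation, `X i ↦ g (X i) g⁻¹`
(recall that `g⁻¹ = gᵀ`). -/
def conj {n s : ℕ} (g : Matrix.orthogonalGroup (Fin s) ℝ) (X : CommSym n s) : CommSym n s :=
  ⟨fun i ↦ g.1 * X.1 i * g.1.transpose, fun i ↦ by
      rw [Matrix.IsSymm, Matrix.transpose_mul, Matrix.transpose_mul, Matrix.transpose_transpose,
        (X.2.1 i).eq, ← Matrix.mul_assoc],
    fun i j ↦ by
      have hg : g.1.transpose * g.1 = 1 := (Matrix.mem_orthogonalGroup_iff' (Fin s) ℝ).1 g.2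
      have key : ∀ A B : Matrix (Fin s) (Fin s) ℝ,
          g.1 * A * g.1.transpose * (g.1 * B * g.1.transpose) =
            g.1 * (A * B) * g.1.transpose := fun A B ↦ by
        calc _ = g.1 * A * (g.1.transpose * g.1) * B * g.1.transpose := by noncomm_ring
          _ = _ := by rw [hg]; noncomm_ring
      rw [Commute, SemiconjBy, key, key, (X.2.2 i j).eq]⟩

/-- The linear isometry of `ℝ^s` given by `g ∈ O(s)`. -/
def orthIsometry {s : ℕ} (g : Matrix.orthogonalGroup (Fin s) ℝ) :
    EuclideanSpace ℝ (Fin s) →ₗᵢ[ℝ] EuclideanSpace ℝ (Fin s) :=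
  (Matrix.toEuclideanLin g.1).isometryOfInner fun x y ↦ by
    have hg : g.1.transpose * g.1 = 1 := (Matrix.mem_orthogonalGroup_iff' (Fin s) ℝ).1 g.2
    simp only [EuclideanSpace.inner_eq_star_dotProduct, Matrix.ofLp_toLpLin, Matrix.toLin'_apply,
      star_trivial]
    rw [Matrix.dotProduct_mulVec, Matrix.vecMul_mulVec, hg, Matrix.vecMul_one]

/-- The action of `σ ∈ Σ_n` on `C_n(𝔰𝔶𝔪_s)`: `(σ X) i = X (σ⁻¹ i)`. -/
def tuplePerm {n s : ℕ} (σ : Equiv.Perm (Fin n)) (X : CommSym n s) : CommSym n s :=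
  ⟨fun i ↦ X.1 (σ⁻¹ i), fun _ ↦ X.2.1 _, fun _ _ ↦ X.2.2 _ _⟩

/-- The identifications on `C_n(𝔰𝔶𝔪_s)⁺ × L(ℝ^s, Sym(ℝ^n))_+` that define the balanced smash product:
the wedge of the two pointed factors is collapsed to a point, and `O(s)`-orbits are identified. Here
`L_+ = L ⊕ Unit` has the disjoint basepoint `Sum.inr ()`, and `O(s)` acts on `L` by
precomposition. -/
inductive SmashRel (n s : ℕ) :
    OnePoint (CommSym n s) × (L (EuclideanSpace ℝ (Fin s)) (SymSpace n) ⊕ Unit) →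
    OnePoint (CommSym n s) × (L (EuclideanSpace ℝ (Fin s)) (SymSpace n) ⊕ Unit) → Prop
  | wedge {a b} (ha : a.1 = ∞ ∨ a.2 = Sum.inr ()) (hb : b.1 = ∞ ∨ b.2 = Sum.inr ()) :
      SmashRel n s a b
  | balance (g : Matrix.orthogonalGroup (Fin s) ℝ) (X : OnePoint (CommSym n s))
      (f : EuclideanSpace ℝ (Fin s) →ₗᵢ[ℝ] SymSpace n) :
      SmashRel n s (X, Sum.inl (f.comp (orthIsometry g))) (X.map (conj g), Sum.inl f)

/-- The half-smash product `C_n(𝔰𝔶𝔪_s)⁺ ∧_{O(s)} L(ℝ^s, Sym(ℝ^n))_+`. -/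
def HalfSmash (n s : ℕ) : Type := Quot (SmashRel n s)

instance (n s : ℕ) : TopologicalSpace (HalfSmash n s) :=
  inferInstanceAs (TopologicalSpace (Quot (SmashRel n s)))

/-- The basepoint of the half-smash product. -/
def HalfSmash.base (n s : ℕ) : HalfSmash n s := Quot.mk _ (∞, Sum.inr ())

/-- Postcomposition with `σ_*` on `L(ℝ^s, Sym(ℝ^n))`. -/
def postPerm {n s : ℕ} (σ : Equiv.Perm (Fin n)) (f : L (EuclideanSpace ℝ (Fin s)) (SymSpace n)) :
    L (EuclideanSpace ℝ (Fin s)) (SymSpace n) :=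
  (SymSpace.perm σ).comp f

lemma postPerm_one {n s : ℕ} (f : L (EuclideanSpace ℝ (Fin s)) (SymSpace n)) :
    postPerm 1 f = f := by
  rw [postPerm, SymSpace.perm_one]
  rfl

lemma postPerm_mul {n s : ℕ} (σ τ : Equiv.Perm (Fin n))
    (f : L (EuclideanSpace ℝ (Fin s)) (SymSpace n)) :
    postPerm (σ * τ) f = postPerm σ (postPerm τ f) := by
  rw [postPerm, SymSpace.perm_mul]
  rfl

lemma tuplePerm_conj {n s : ℕ} (σ : Equiv.Perm (Fin n)) (g : Matrix.orthogonalGroup (Fin s) ℝ)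
    (X : OnePoint (CommSym n s)) :
    (X.map (conj g)).map (tuplePerm σ) = (X.map (tuplePerm σ)).map (conj g) := by
  rw [← Function.comp_apply (f := OnePoint.map (tuplePerm σ)), ← OnePoint.map_comp,
    ← Function.comp_apply (f := OnePoint.map (conj g)), ← OnePoint.map_comp]
  rfl

lemma tuplePerm_one {n s : ℕ} (X : OnePoint (CommSym n s)) : X.map (tuplePerm 1) = X := by
  have h : (tuplePerm 1 : CommSym n s → CommSym n s) = id := rfl
  rw [h, OnePoint.map_id, id]

lemma tuplePerm_mul {n s : ℕ} (σ τ : Equiv.Perm (Fin n)) (X : OnePoint (CommSym n s)) :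
    X.map (tuplePerm (σ * τ)) = (X.map (tuplePerm τ)).map (tuplePerm σ) := by
  have h : (tuplePerm (σ * τ) : CommSym n s → CommSym n s) = tuplePerm σ ∘ tuplePerm τ := rfl
  rw [h, OnePoint.map_comp, Function.comp_apply]

/-- The self-map `[X ∧ f] ↦ [σ X ∧ (σ_* ∘ f)]` of the half-smash product. -/
def HalfSmash.perm {n s : ℕ} (σ : Equiv.Perm (Fin n)) : HalfSmash n s → HalfSmash n s :=
  Quot.map (Prod.map (OnePoint.map (tuplePerm σ)) (Sum.map (postPerm σ) id)) (by
    rintro _ _ (⟨ha, hb⟩ | ⟨g, X, f⟩)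
    · refine SmashRel.wedge (ha.imp ?_ ?_) (hb.imp ?_ ?_)
      all_goals
        intro h
        simp [h]
    · have := SmashRel.balance g (X.map (tuplePerm σ)) ((SymSpace.perm σ).comp f)
      rw [← tuplePerm_conj] at this
      exact this)

/-- The class `[X ∧ y]` in the half-smash product. -/
def HalfSmash.mk {n s : ℕ} (X : OnePoint (CommSym n s))
    (y : L (EuclideanSpace ℝ (Fin s)) (SymSpace n) ⊕ Unit) : HalfSmash n s :=
  Quot.mk _ (X, y)

lemma HalfSmash.cases {n s : ℕ} {P : HalfSmash n s → Prop}
    (hl : ∀ X f, P (HalfSmash.mk X (Sum.inl f))) (hr : ∀ X, P (HalfSmash.mk X (Sum.inr ())))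
    (z : HalfSmash n s) : P z :=
  Quot.ind (fun w ↦ Prod.casesOn w fun X y ↦ Sum.casesOn y (hl X) fun _ ↦ hr X) z

lemma HalfSmash.perm_inl {n s : ℕ} (σ : Equiv.Perm (Fin n)) (X : OnePoint (CommSym n s))
    (f : L (EuclideanSpace ℝ (Fin s)) (SymSpace n)) :
    HalfSmash.perm σ (HalfSmash.mk X (Sum.inl f)) =
      HalfSmash.mk (X.map (tuplePerm σ)) (Sum.inl (postPerm σ f)) := rfl

lemma HalfSmash.perm_inr {n s : ℕ} (σ : Equiv.Perm (Fin n)) (X : OnePoint (CommSym n s)) :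
    HalfSmash.perm σ (HalfSmash.mk X (Sum.inr ())) =
      HalfSmash.mk (X.map (tuplePerm σ)) (Sum.inr ()) := rfl

lemma HalfSmash.perm_one {n s : ℕ} (z : HalfSmash n s) : HalfSmash.perm 1 z = z := by
  induction z using HalfSmash.cases with
  | hl X f => rw [HalfSmash.perm_inl, tuplePerm_one, postPerm_one]
  | hr X => rw [HalfSmash.perm_inr, tuplePerm_one]

lemma HalfSmash.perm_mul {n s : ℕ} (σ τ : Equiv.Perm (Fin n)) (z : HalfSmash n s) :
    HalfSmash.perm (σ * τ) z = HalfSmash.perm σ (HalfSmash.perm τ z) := by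
  induction z using HalfSmash.cases with
  | hl X f => simp only [HalfSmash.perm_inl, tuplePerm_mul, postPerm_mul]
  | hr X => simp only [HalfSmash.perm_inr, tuplePerm_mul]

/-- The action of `Σ_n` on the half-smash product: `σ [X ∧ f] = [σ X ∧ (σ_* ∘ f)]`. -/
instance (n s : ℕ) : MulAction (Equiv.Perm (Fin n)) (HalfSmash n s) where
  smul := HalfSmash.perm
  one_smul := HalfSmash.perm_one
  mul_smul := HalfSmash.perm_mul

end Commuting

end KO

end

/-! Both sides are quotients of the same space Z = (L(ℝ^s, U) × (S^n)^s) ⊔ pt, with U = Sym(ℝ^n),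
and the two quotient maps have the same fibres. A pair (f, x) goes to the configuration of the lines
ℝ f(e_i) at the points x_i (`lineQuot`), and to the class of diag(x) ∧ f (`smashQuot`), where
diag(x) is read as ∞ as soon as one x_i is ∞. The extra point goes to the basepoints.

Fibres. Away from the basepoint, a point on either side is determined by a function from S^n ∖ {∞}
to subspaces of U: for a configuration, y ↦ the sum of the V_i with x_i = y; for X ∧ f, y ↦ the
image under f of the joint eigenspace of X at y. These functions agree on Z
(`collapseLabel_eq_smashLabel`), and each separates points (`collapseLabel_injective`,
`smashLabel_injective`). The spectral theorem for commuting symmetric matrices gives surjectivity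
onto the half-smash product.

Topology. For `lineQuot`, closedness in ko_n is tested on the spaces of frames, which is legitimate
because (S^n)^k is locally compact. There the preimage of a set is a finite union, over sets T of
indices allowed off the basepoint, of closed pieces on which the map lifts to Z
(`isQuotientMap_lineQuot`). For `smashQuot`, the map (g, x) ↦ g diag(x) g⁻¹, extended by ∞, is a map
from a compact space onto the Hausdorff space C_n(𝔰𝔶𝔪_s)⁺. It is therefore proper and remains a
quotient map after taking the product with L(ℝ^s, U), and the resulting map to the half-smash
product factors through Z by moving g into the embedding (`isQuotientMap_smashQuot`).

Equivariance and basepoints can then be checked on Z. -/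

noncomputable section

namespace KO

open Topology

/-! ### Continuity of maps out of spaces of isometric embeddings -/

section Stiefel

variable {V V' W : Type*} [NormedAddCommGroup V] [InnerProductSpace ℝ V]
  [NormedAddCommGroup V'] [InnerProductSpace ℝ V'] [NormedAddCommGroup W] [InnerProductSpace ℝ W]

/-- The isometric embedding underlying a point of `L(V, W)`. -/
def L.iso (f : L V W) : V →ₗᵢ[ℝ] W := f

/-- The inclusion `L(V, W') → L(V, W)` for a subspace `W'` of `W`. -/
def L.incl (W' : Submodule ℝ W) (f : V →ₗᵢ[ℝ] W') : L V W := W'.subtypeₗᵢ.comp f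

/-- Precomposition with an isometric embedding. -/
def L.precomp (f : L V W) (h : V' →ₗᵢ[ℝ] V) : L V' W := f.iso.comp h

lemma L.precomp_apply (f : L V W) (h : V' →ₗᵢ[ℝ] V) (v : V') :
    (f.precomp h).iso v = f.iso (h v) := rfl

lemma L.continuous_dom {Y : Type*} [TopologicalSpace Y] {F : L V W → Y}
    (h : ∀ W' : Submodule ℝ W, FiniteDimensional ℝ W' →
      @Continuous (V →ₗᵢ[ℝ] W') Y (stiefelTopology V W') _ fun f ↦ F (L.incl W' f)) :
    Continuous F :=
  continuous_iSup_dom.2 fun W' ↦ continuous_coinduced_dom.2 (h W'.1 W'.2)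

lemma L.continuous_incl (W' : Submodule ℝ W) [h : FiniteDimensional ℝ W'] :
    @Continuous (V →ₗᵢ[ℝ] W') (L V W) (stiefelTopology V W') _ (L.incl W') :=
  continuous_iSup_rng
    (ι := {W' : Submodule ℝ W // FiniteDimensional ℝ W'}) (i := ⟨W', h⟩) continuous_coinduced_rng

/-- Precomposition with a family of isometric embeddings that depends continuously on a parameter
in a locally compact space. -/
lemma L.continuous_precomp [FiniteDimensional ℝ V] {K : Type*} [TopologicalSpace K]
    [LocallyCompactSpace K] (h : K → V' →ₗᵢ[ℝ] V)
    (hh : Continuous fun k ↦ (h k).toContinuousLinearMap) :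
    Continuous fun p : L V W × K ↦ p.1.precomp (h p.2) := by
  have key : ∀ W' : Submodule ℝ W, FiniteDimensional ℝ W' →
      @Continuous ((V →ₗᵢ[ℝ] W') × K) (L V' W)
        (@instTopologicalSpaceProd _ _ (stiefelTopology V W') _) _
        fun p ↦ (L.incl W' p.1).precomp (h p.2) := by
    intro W' _
    let _ := stiefelTopology V W'
    let _ := stiefelTopology V' W'
    have h1 : Continuous fun p : (V →ₗᵢ[ℝ] W') × K ↦ p.1.comp (h p.2) := by
      refine continuous_induced_rng.2 ?_
      have h2 : Continuous fun p : (V →ₗᵢ[ℝ] W') × K ↦ p.1.toContinuousLinearMap :=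
        (continuous_induced_dom (f := LinearIsometry.toContinuousLinearMap)).comp continuous_fst
      exact h2.clm_comp (hh.comp continuous_snd)
    exact (L.continuous_incl W').comp h1
  -- A single f already lives at the finite stage W' = range f, so `key` applies to it.
  have hc : ∀ f : L V W, Continuous fun k ↦ f.precomp (h k) := by
    intro f
    let W' : Submodule ℝ W := LinearMap.range f.iso.toLinearMap
    let f' : V →ₗᵢ[ℝ] W' := ⟨f.iso.toLinearMap.rangeRestrict, fun x ↦ f.iso.norm_map x⟩
    let _ := stiefelTopology V W'
    exact (key W' inferInstance).comp (Continuous.prodMk_right f')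
  -- The product with K need not obviously carry the colimit topology, so the map is curried:
  -- continuity into the mapping space can be tested on each L(V, W'), and local compactness of K
  -- allows uncurrying.
  let G : L V W → C(K, L V' W) := fun f ↦ ⟨_, hc f⟩
  have hG : Continuous G := by
    refine L.continuous_dom fun W' hW' ↦ ?_
    let _ := stiefelTopology V W'
    exact (ContinuousMap.curry ⟨_, key W' hW'⟩).continuous
  exact ContinuousMap.continuous_uncurry_of_continuous ⟨G, hG⟩

lemma L.continuous_comp_right [FiniteDimensional ℝ V] (h : V' →ₗᵢ[ℝ] V) :
    Continuous fun f : L V W ↦ f.precomp h :=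
  (L.continuous_precomp (fun _ : Unit ↦ h) continuous_const).comp (Continuous.prodMk_left ())

end Stiefel

/-! ### Reindexing of Euclidean spaces -/

section Reindex

variable {κ κ' : Type*} [Fintype κ] [DecidableEq κ] [Fintype κ'] [DecidableEq κ']

lemma orthonormal_single : Orthonormal ℝ fun i : κ ↦ EuclideanSpace.single i (1 : ℝ) := by
  have h : (fun i : κ ↦ EuclideanSpace.single i (1 : ℝ)) = EuclideanSpace.basisFun κ ℝ :=
    funext fun i ↦ (EuclideanSpace.basisFun_apply κ ℝ i).symm
  rw [h]
  exact (EuclideanSpace.basisFun κ ℝ).orthonormal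

lemma orthonormal_comp_single {W : Type*} [NormedAddCommGroup W] [InnerProductSpace ℝ W]
    (f : EuclideanSpace ℝ κ →ₗᵢ[ℝ] W) :
    Orthonormal ℝ fun i : κ ↦ f (EuclideanSpace.single i (1 : ℝ)) :=
  orthonormal_single.comp_linearIsometry f

/-- The isometric embedding that extends an orthonormal family. -/
def ofOrthonormal {W : Type*} [NormedAddCommGroup W] [InnerProductSpace ℝ W] {v : κ → W}
    (hv : Orthonormal ℝ v) : EuclideanSpace ℝ κ →ₗᵢ[ℝ] W :=
  ((EuclideanSpace.basisFun κ ℝ).toBasis.constr ℝ v).isometryOfOrthonormal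
    (v := (EuclideanSpace.basisFun κ ℝ).toBasis) (by simp)
    (by convert hv using 1; ext1 i; exact Module.Basis.constr_basis _ _ _ _)

lemma ofOrthonormal_single {W : Type*} [NormedAddCommGroup W] [InnerProductSpace ℝ W] {v : κ → W}
    (hv : Orthonormal ℝ v) (i : κ) : ofOrthonormal hv (EuclideanSpace.single i 1) = v i := by
  have h := Module.Basis.constr_basis (EuclideanSpace.basisFun κ ℝ).toBasis ℝ v i
  rw [OrthonormalBasis.coe_toBasis, EuclideanSpace.basisFun_apply] at h
  exact h

/-- The isometric embedding `e_i ↦ e_(ε i)`. -/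
def reindexIsometry (ε : κ ↪ κ') : EuclideanSpace ℝ κ →ₗᵢ[ℝ] EuclideanSpace ℝ κ' :=
  ofOrthonormal (orthonormal_single.comp ε ε.injective)

lemma reindexIsometry_single (ε : κ ↪ κ') (i : κ) :
    reindexIsometry ε (EuclideanSpace.single i 1) = EuclideanSpace.single (ε i) 1 :=
  ofOrthonormal_single _ i

lemma isometry_ext {W : Type*} [NormedAddCommGroup W] [InnerProductSpace ℝ W]
    {f g : EuclideanSpace ℝ κ →ₗᵢ[ℝ] W}
    (h : ∀ i, f (EuclideanSpace.single i 1) = g (EuclideanSpace.single i 1)) : f = g := by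
  apply LinearIsometry.toLinearMap_injective
  exact (EuclideanSpace.basisFun κ ℝ).toBasis.ext fun i ↦ by simpa using h i

/-- The vectors supported in `P` are spanned by the basis vectors with index in `P`. -/
lemma mem_span_single_iff (P : Set κ) (v : EuclideanSpace ℝ κ) :
    v ∈ Submodule.span ℝ ((fun i ↦ EuclideanSpace.single i (1 : ℝ)) '' P) ↔
      ∀ i, i ∉ P → v i = 0 := by
  constructor
  · intro h
    induction h using Submodule.span_induction with
    | mem x hx =>
      obtain ⟨j, hj, rfl⟩ := hx
      intro i hi
      have : i ≠ j := fun h ↦ hi (h ▸ hj)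
      simp [this]
    | zero => simp
    | add x y _ _ hx hy => intro i hi; simp [hx i hi, hy i hi]
    | smul c x _ hx => intro i hi; simp [hx i hi]
  · intro h
    have hv := (EuclideanSpace.basisFun κ ℝ).sum_repr v
    simp only [EuclideanSpace.basisFun_repr, EuclideanSpace.basisFun_apply] at hv
    rw [← hv]
    refine Submodule.sum_mem _ fun i _ ↦ ?_
    by_cases hi : i ∈ P
    · exact Submodule.smul_mem _ _ (Submodule.subset_span ⟨i, hi, rfl⟩)
    · rw [h i hi, zero_smul]
      exact Submodule.zero_mem _

end Reindex

lemma finrank_span_image {κ W : Type*} [Fintype κ] [NormedAddCommGroup W] [InnerProductSpace ℝ W]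
    {v : κ → W}
    (hv : Orthonormal ℝ v) (P : Set κ) [DecidablePred (· ∈ P)] :
    Module.finrank ℝ (Submodule.span ℝ (v '' P)) = (Finset.univ.filter (· ∈ P)).card := by
  have h := (hv.comp ((↑) : P → κ) Subtype.val_injective).linearIndependent
  have := finrank_span_eq_card h
  rw [Set.range_comp, Subtype.range_coe] at this
  rw [this, Fintype.card_subtype]

/-! ### Maps to a one-point compactification -/

/-- Open sets of C⁺ are the open sets of C and the complements of closed compact subsets of C. The
second hypothesis is a form of properness. -/
lemma continuous_onePoint_of {P C : Type*} [TopologicalSpace P] [TopologicalSpace C]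
    {θ : P → OnePoint C} (h₁ : ∀ u : Set C, IsOpen u → IsOpen (θ ⁻¹' ((↑) '' u)))
    (h₂ : ∀ K : Set C, IsClosed K → IsCompact K → IsClosed (θ ⁻¹' ((↑) '' K))) :
    Continuous θ := by
  refine continuous_def.2 fun t ht ↦ ?_
  by_cases hi : ∞ ∈ t
  · obtain ⟨hc, hk⟩ := (OnePoint.isOpen_iff_of_mem hi).1 ht
    have := (h₂ _ hc hk).isOpen_compl
    convert this using 1
    rw [← Set.preimage_compl]
    congr 1
    rw [OnePoint.compl_image_coe, compl_compl]
    ext x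
    induction x using OnePoint.rec with
    | infty => simp [hi]
    | coe x => simp
  · have := h₁ _ ((OnePoint.isOpen_iff_of_notMem hi).1 ht)
    convert this using 2
    ext x
    induction x using OnePoint.rec with
    | infty => simp [hi]
    | coe x => simp

/-! ### Labels and rank of a configuration -/

section Label

variable {U : Type*} [NormedAddCommGroup U] [InnerProductSpace ℝ U] {X : Type*} {pt : X}

/-- The total label of a configuration at a point `y` other than the basepoint. -/
def Conf.label (c : Conf U pt) (y : {y : X // y ≠ pt}) : Submodule ℝ U :=
  Quot.lift (fun p : Σ k : ℕ, OrthTuple U k × (Fin k → X) ↦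
    ⨆ i, ⨆ _ : p.2.2 i = y.1, p.2.1.space i) (by
      rintro _ _ ⟨α, V, x⟩
      simp only [OrthTuple.push]
      refine le_antisymm (iSup₂_le fun i hi ↦ iSup_le fun j ↦ ?_) (iSup₂_le fun j hj ↦ ?_)
      · refine le_iSup₂_of_le (f := fun j _ ↦ V.space j) j.1 ?_ le_rfl
        simp [pullPoints, j.2, hi]
      · cases hα : α j with
        -- A label sent to the basepoint sits at `pt` after pulling back, and y ≠ `pt`. For this
        -- reason labels are only recorded off the basepoint.
        | none => exact absurd (by simpa [pullPoints, hα] using hj.symm) y.2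
        | some i =>
          refine le_iSup₂_of_le i (by simpa [pullPoints, hα] using hj) ?_
          exact le_iSup (fun j : {j // α j = some i} ↦ V.space j) ⟨j, hα⟩) c

lemma Conf.label_mk {k : ℕ} (V : OrthTuple U k) (x : Fin k → X) (y : {y : X // y ≠ pt}) :
    (Conf.mk pt V x).label y = ⨆ i, ⨆ _ : x i = y.1, V.space i := rfl

/-- One coend relation suffices, along the map sending j to the index of `x j` in the list `e`, or
to the basepoint if `x j = pt`. It merges labels at equal points, drops those at `pt` and fills
unused entries of `e` with zero subspaces. Since `e` may be longer than the support, two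
configurations can be written over the same list. -/
lemma Conf.exists_eq_mk_of_injective {k l : ℕ} (V : OrthTuple U k) (x : Fin k → X) (e : Fin l → X)
    (he : Function.Injective e) (hpt : ∀ i, e i ≠ pt) (hx : ∀ j, x j ≠ pt → ∃ i, e i = x j) :
    ∃ W : OrthTuple U l, Conf.mk pt V x = Conf.mk pt W e ∧
      ∀ i, W.space i = (Conf.mk pt V x).label ⟨e i, hpt i⟩ := by
  classical
  let α : Fin k → Option (Fin l) := fun j ↦ if h : x j ≠ pt then some (hx j h).choose else none
  have hα : ∀ j i, α j = some i ↔ x j = e i := by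
    intro j i
    by_cases h : x j ≠ pt
    · simp only [α, dif_pos h, Option.some.injEq]
      rw [← he.eq_iff, (hx j h).choose_spec]
    · simp only [α, dif_neg h]
      rw [not_not] at h
      simp [h, (hpt i).symm]
  have hp : pullPoints pt α e = x := by
    funext j
    by_cases h : x j ≠ pt
    · simp only [pullPoints, α, dif_pos h, Option.elim]
      exact (hx j h).choose_spec
    · simp only [pullPoints, α, dif_neg h, Option.elim]
      rw [not_not] at h
      exact h.symm
  refine ⟨V.push α, ?_, fun i ↦ ?_⟩
  · have := Quot.sound (CoendRel.glue (pt := pt) α V e)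
    rw [hp] at this
    exact this.symm
  · rw [Conf.label_mk]
    simp only [OrthTuple.push, iSup_subtype, hα]

/-- A configuration is determined by its labels. -/
lemma Conf.label_injective : Function.Injective (Conf.label : Conf U pt → _) := by
  classical
  rintro ⟨k, V, x⟩ ⟨k', V', x'⟩ h
  change (Conf.mk pt V x).label = (Conf.mk pt V' x').label at h
  change Conf.mk pt V x = Conf.mk pt V' x'
  -- The common list consists of all points of both configurations, without the basepoint.
  let S : Finset X := (Finset.univ.image x ∪ Finset.univ.image x').erase pt
  let e : Fin S.card → X := fun i ↦ (S.equivFin.symm i).1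
  have he : Function.Injective e := Subtype.val_injective.comp S.equivFin.symm.injective
  have hpt : ∀ i, e i ≠ pt := fun i ↦ (Finset.mem_erase.1 (S.equivFin.symm i).2).1
  have hS : ∀ y ∈ S, ∃ i, e i = y := fun y hy ↦ ⟨S.equivFin ⟨y, hy⟩, by simp [e]⟩
  obtain ⟨W, hW, hW'⟩ := Conf.exists_eq_mk_of_injective V x e he hpt
    fun j hj ↦ hS _ (by simp [S, hj])
  obtain ⟨W₂, hW₂, hW₂'⟩ := Conf.exists_eq_mk_of_injective V' x' e he hpt
    fun j hj ↦ hS _ (by simp [S, hj])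
  rw [hW, hW₂]
  congr 1
  ext1
  funext i
  rw [hW', hW₂', h]

/-- The total dimension of the labels off the basepoint. -/
def Conf.rank (c : Conf U pt) : ℕ := Module.finrank ℝ (⨆ y, c.label y : Submodule ℝ U)

lemma OrthTuple.ofFrame_space {k : ℕ} (m : Fin k → ℕ)
    (f : EuclideanSpace ℝ (Σ i, Fin (m i)) →ₗᵢ[ℝ] U) (i : Fin k) :
    (OrthTuple.ofFrame m f).space i =
      Submodule.span ℝ ((fun p ↦ f (EuclideanSpace.single p 1)) '' {p | p.1 = i}) := by
  have h : block m i =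
      Submodule.span ℝ ((fun p ↦ EuclideanSpace.single p (1 : ℝ)) '' {p | p.1 = i}) := by
    ext v
    rw [mem_span_single_iff]
    rfl
  change (block m i).map f.toLinearMap = _
  rw [h, Submodule.map_span, Set.image_image]
  rfl

lemma OrthTuple.finrank_ofFrame_space {k : ℕ} (m : Fin k → ℕ)
    (f : EuclideanSpace ℝ (Σ i, Fin (m i)) →ₗᵢ[ℝ] U) (i : Fin k) :
    Module.finrank ℝ ((OrthTuple.ofFrame m f).space i) = m i := by
  classical
  rw [OrthTuple.ofFrame_space, finrank_span_image (orthonormal_comp_single f)]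
  have : (Finset.univ.filter (· ∈ {p : Σ i, Fin (m i) | p.1 = i})) =
      ({i} : Finset (Fin k)).sigma fun i ↦ (Finset.univ : Finset (Fin (m i))) := by
    ext p
    simp
  rw [this, Finset.card_sigma]
  simp

/-- Every tuple of mutually orthogonal subspaces is spanned by a frame. -/
lemma OrthTuple.exists_ofFrame_eq {k : ℕ} (V : OrthTuple U k) :
    ∃ (m : Fin k → ℕ) (f : EuclideanSpace ℝ (Σ i, Fin (m i)) →ₗᵢ[ℝ] U),
      OrthTuple.ofFrame m f = V := by
  have := V.finite
  let m : Fin k → ℕ := fun i ↦ Module.finrank ℝ (V.space i)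
  have hV : OrthogonalFamily ℝ (fun i ↦ V.space i) fun i ↦ (V.space i).subtypeₗᵢ :=
    OrthogonalFamily.of_pairwise V.orth
  have hb := hV.orthonormal_sigma_orthonormal
    (v_family := fun i ↦ stdOrthonormalBasis ℝ (V.space i))
    fun i ↦ (stdOrthonormalBasis ℝ (V.space i)).orthonormal
  refine ⟨m, ofOrthonormal hb, ?_⟩
  ext1
  funext i
  rw [OrthTuple.ofFrame_space]
  simp only [ofOrthonormal_single]
  have h1 : ((fun a : Σ i, Fin (m i) ↦
      (V.space a.1).subtypeₗᵢ (stdOrthonormalBasis ℝ (V.space a.1) a.2)) '' {p | p.1 = i}) =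
      (V.space i).subtype '' Set.range (stdOrthonormalBasis ℝ (V.space i)) := by
    ext u
    constructor
    · rintro ⟨⟨j, a⟩, rfl, rfl⟩
      exact ⟨_, ⟨a, rfl⟩, rfl⟩
    · rintro ⟨_, ⟨a, rfl⟩, rfl⟩
      exact ⟨⟨i, a⟩, rfl, rfl⟩
  rw [h1, ← Submodule.map_span, ← OrthonormalBasis.coe_toBasis, Module.Basis.span_eq,
    Submodule.map_top, Submodule.range_subtype]

lemma Conf.label_ofFrame {k : ℕ} (m : Fin k → ℕ)
    (f : EuclideanSpace ℝ (Σ i, Fin (m i)) →ₗᵢ[ℝ] U) (x : Fin k → X) (y : {y : X // y ≠ pt}) :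
    (Conf.mk pt (OrthTuple.ofFrame m f) x).label y =
      Submodule.span ℝ ((fun p ↦ f (EuclideanSpace.single p 1)) '' {p | x p.1 = y}) := by
  simp only [Conf.label_mk, OrthTuple.ofFrame_space, ← Submodule.span_iUnion, ← Set.image_iUnion]
  congr 2
  ext p
  simp

/-- The labels off the basepoint are jointly spanned by those members of an orthonormal family whose
block sits at a point other than `pt`. -/
lemma Conf.rank_ofFrame [DecidableEq X] {k : ℕ} (m : Fin k → ℕ)
    (f : EuclideanSpace ℝ (Σ i, Fin (m i)) →ₗᵢ[ℝ] U) (x : Fin k → X) :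
    (Conf.mk pt (OrthTuple.ofFrame m f) x).rank = ∑ i with x i ≠ pt, m i := by
  classical
  rw [Conf.rank, iSup_congr (Conf.label_ofFrame m f x)]
  rw [← Submodule.span_iUnion, ← Set.image_iUnion, finrank_span_image (orthonormal_comp_single f)]
  have : (Finset.univ.filter
      (· ∈ ⋃ y : {y : X // y ≠ pt}, {p : Σ i, Fin (m i) | x p.1 = y})) =
      (Finset.univ.filter fun i ↦ x i ≠ pt).sigma
        fun i ↦ (Finset.univ : Finset (Fin (m i))) := by
    ext p
    simp
  rw [this, Finset.card_sigma]
  simp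

/-- The filtration asks for some presentation with small total dimension. That total does not depend
on the presentation, because it is the dimension of the sum of all labels. -/
lemma mem_rankFiltration_iff {r : ℤ} {c : Conf U pt} :
    c ∈ rankFiltration U pt r ↔ (c.rank : ℤ) ≤ r := by
  classical
  have key : ∀ (k : ℕ) (V : OrthTuple U k) (x : Fin k → X),
      (Conf.mk pt V x).rank = ∑ i with x i ≠ pt, Module.finrank ℝ (V.space i) := by
    intro k V x
    obtain ⟨m, f, rfl⟩ := V.exists_ofFrame_eq
    simp only [Conf.rank_ofFrame, OrthTuple.finrank_ofFrame_space]
  constructor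
  · rintro ⟨k, V, x, rfl, h⟩
    rw [key]
    convert h
  · intro h
    obtain ⟨k, V, x⟩ := c
    refine ⟨k, V, x, rfl, ?_⟩
    change ((Conf.mk pt V x).rank : ℤ) ≤ r at h
    rw [key] at h
    convert h

end Label

/-! ### Configurations of lines -/

section Lines

variable {U : Type*} [NormedAddCommGroup U] [InnerProductSpace ℝ U] {X : Type*} (pt : X)

/-- The index map of a tuple of lines. -/
def sigmaFinOne (s : ℕ) : (Σ _ : Fin s, Fin 1) ↪ Fin s :=
  ⟨Sigma.fst, by
    rintro ⟨i, a⟩ ⟨j, b⟩ (rfl : i = j)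
    rw [Subsingleton.elim a b]⟩

/-- The configuration `[(ℝ f(e_1), x 1), …, (ℝ f(e_s), x s)]`. -/
def lineConf {s : ℕ} (z : L (EuclideanSpace ℝ (Fin s)) U × (Fin s → X)) : Conf U pt :=
  Conf.mk pt (OrthTuple.ofFrame (fun _ ↦ 1)
    (z.1.precomp (reindexIsometry (sigmaFinOne s))).iso) z.2

variable {pt}

lemma label_lineConf {s : ℕ} (z : L (EuclideanSpace ℝ (Fin s)) U × (Fin s → X))
    (y : {y : X // y ≠ pt}) :
    (lineConf pt z).label y =
      Submodule.span ℝ ((fun i ↦ z.1.iso (EuclideanSpace.single i 1)) '' {i | z.2 i = y}) := by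
  rw [lineConf, Conf.label_ofFrame]
  congr 1
  ext u
  constructor
  · rintro ⟨p, hp, rfl⟩
    refine ⟨p.1, hp, ?_⟩
    simp only [L.precomp_apply, reindexIsometry_single]
    rfl
  · rintro ⟨i, hi, rfl⟩
    refine ⟨⟨i, 0⟩, hi, ?_⟩
    simp only [L.precomp_apply, reindexIsometry_single]
    rfl

lemma rank_lineConf [DecidableEq X] {s : ℕ}
    (z : L (EuclideanSpace ℝ (Fin s)) U × (Fin s → X)) :
    (lineConf pt z).rank = (Finset.univ.filter fun i ↦ z.2 i ≠ pt).card := by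
  rw [lineConf, Conf.rank_ofFrame]
  simp

lemma rank_lineConf_le {s : ℕ} (z : L (EuclideanSpace ℝ (Fin s)) U × (Fin s → X)) :
    (lineConf pt z).rank ≤ s := by
  classical
  rw [rank_lineConf]
  exact (Finset.card_le_univ _).trans_eq (Fintype.card_fin s)

lemma rank_lineConf_eq_iff {s : ℕ} (z : L (EuclideanSpace ℝ (Fin s)) U × (Fin s → X)) :
    (lineConf pt z).rank = s ↔ ∀ i, z.2 i ≠ pt := by
  classical
  rw [rank_lineConf]
  have := Finset.card_filter_eq_iff (s := (Finset.univ : Finset (Fin s)))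
    (p := fun i ↦ z.2 i ≠ pt)
  rw [Finset.card_univ, Fintype.card_fin] at this
  simpa using this

/-- A choice of all basis vectors in the blocks with index in `T`. -/
lemma exists_blockIndex {k s : ℕ} (m : Fin k → ℕ) (T : Finset (Fin k)) (hT : ∑ i ∈ T, m i = s) :
    ∃ ε : Fin s ↪ Σ i, Fin (m i), ∀ p, p ∈ Set.range ε ↔ p.1 ∈ T := by
  have hc : Fintype.card (T.sigma fun i ↦ (Finset.univ : Finset (Fin (m i)))) = s := by
    rw [Fintype.card_coe, Finset.card_sigma]
    simpa using hT
  let e := (Fintype.equivFinOfCardEq hc).symm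
  refine ⟨e.toEmbedding.trans (Function.Embedding.subtype _), fun p ↦ ⟨?_, fun hp ↦ ?_⟩⟩
  · rintro ⟨i, rfl⟩
    exact (Finset.mem_sigma.1 (e i).2).1
  · exact ⟨e.symm ⟨p, by simpa using hp⟩, by simp⟩

/-- Blocks outside `T` sit at `pt` and contribute to no label. Points with index in `T` may also be
`pt`, so the condition on `x` is closed, and the rank may drop below s. -/
lemma lineConf_precomp {k s : ℕ} (m : Fin k → ℕ) (T : Finset (Fin k))
    (ε : Fin s ↪ Σ i, Fin (m i)) (hε : ∀ p, p ∈ Set.range ε ↔ p.1 ∈ T)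
    (f : L (EuclideanSpace ℝ (Σ i, Fin (m i))) U) (x : Fin k → X) (hx : ∀ i ∉ T, x i = pt) :
    lineConf pt (f.precomp (reindexIsometry ε), fun i ↦ x (ε i).1) =
      Conf.mk pt (OrthTuple.ofFrame m f.iso) x := by
  apply Conf.label_injective
  funext y
  rw [label_lineConf]
  refine Eq.trans ?_ (Conf.label_ofFrame m f.iso x y).symm
  congr 1
  simp only [L.precomp_apply, reindexIsometry_single]
  ext u
  constructor
  · rintro ⟨i, hi, rfl⟩
    exact ⟨ε i, hi, rfl⟩
  · rintro ⟨p, hp, rfl⟩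
    obtain ⟨i, rfl⟩ : p ∈ Set.range ε := by
      rw [hε]
      by_contra h
      exact y.2 (hp.symm.trans (hx _ h))
    exact ⟨i, hp, rfl⟩

/-- Every configuration of rank `s` is a configuration of `s` lines. -/
lemma exists_lineConf_eq {s : ℕ} {c : Conf U pt} (hc : c.rank = s) :
    ∃ z : L (EuclideanSpace ℝ (Fin s)) U × (Fin s → X), lineConf pt z = c := by
  classical
  obtain ⟨k, V, x⟩ := c
  obtain ⟨m, f, rfl⟩ := V.exists_ofFrame_eq
  change (Conf.mk pt _ x).rank = s at hc
  rw [Conf.rank_ofFrame] at hc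
  obtain ⟨ε, hε⟩ := exists_blockIndex m _ hc
  exact ⟨_, lineConf_precomp m _ ε hε f x fun i hi ↦ by simpa using hi⟩

lemma lineConf_map {s : ℕ} (φ : U →ₗᵢ[ℝ] U) (h : X → X) (hpt : h pt = pt)
    (z : L (EuclideanSpace ℝ (Fin s)) U × (Fin s → X)) :
    Conf.map φ h hpt (lineConf pt z) = lineConf pt (φ.comp z.1.iso, h ∘ z.2) := by
  refine congrArg (fun V ↦ Conf.mk pt V (h ∘ z.2)) ?_
  ext1
  funext i
  exact (Submodule.map_comp _ _ _).symm

variable (pt) in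
/-- The map from configurations of `s` lines, with a disjoint basepoint, to `R^s / R^(s-1)`. -/
def lineQuot (s : ℕ) : (L (EuclideanSpace ℝ (Fin s)) U × (Fin s → X)) ⊕ Unit →
    Collapse (rankFiltration U pt s) (rankFiltration U pt ((s : ℤ) - 1)) :=
  Sum.elim (fun z ↦ Quot.mk _ (Sum.inl ⟨lineConf pt z,
    mem_rankFiltration_iff.2 (by exact_mod_cast rank_lineConf_le z)⟩)) fun u ↦ Quot.mk _ (Sum.inr u)


lemma lineQuot_eq_mk {s : ℕ} (z : L (EuclideanSpace ℝ (Fin s)) U × (Fin s → X)) {c : Conf U pt}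
    (hz : lineConf pt z = c) (hc : c ∈ rankFiltration U pt s) :
    lineQuot pt s (Sum.inl z) = Quot.mk _ (Sum.inl ⟨c, hc⟩) := by
  subst hz
  rfl

lemma lineQuot_inr_eq_mk {s : ℕ} {c : Conf U pt} (h : c.rank < s)
    (hc : c ∈ rankFiltration U pt s) :
    lineQuot pt s (Sum.inr ()) = Quot.mk _ (Sum.inl ⟨c, hc⟩) :=
  (Quot.sound (CollapseRel.collapse ⟨c, hc⟩ (mem_rankFiltration_iff.2 (by dsimp only; omega)))).symm

lemma lineQuot_surjective (s : ℕ) : Function.Surjective (lineQuot (U := U) pt s) := by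
  rintro ⟨⟨c, hc⟩ | u⟩
  · rcases (by exact_mod_cast mem_rankFiltration_iff.1 hc : c.rank ≤ s).lt_or_eq with h | h
    · exact ⟨_, lineQuot_inr_eq_mk h hc⟩
    · obtain ⟨z, hz⟩ := exists_lineConf_eq h
      exact ⟨_, lineQuot_eq_mk z hz hc⟩
  · exact ⟨Sum.inr u, rfl⟩

open Classical in
/-- The labels of a point of `R^s / R^(s-1)` other than the basepoint. -/
def collapseLabel {s : ℕ} :
    Collapse (rankFiltration U pt s) (rankFiltration U pt ((s : ℤ) - 1)) →
      Option ({y : X // y ≠ pt} → Submodule ℝ U) :=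
  Quot.lift (Sum.elim (fun c ↦ if c.1.rank = s then some c.1.label else none) fun _ ↦ none) (by
    rintro _ _ ⟨c, hc⟩
    have := mem_rankFiltration_iff.1 hc
    exact if_neg (by omega))

lemma collapseLabel_inl {s : ℕ} {z : L (EuclideanSpace ℝ (Fin s)) U × (Fin s → X)}
    (hz : ∀ i, z.2 i ≠ pt) :
    collapseLabel (lineQuot pt s (Sum.inl z)) = some (lineConf pt z).label :=
  if_pos ((rank_lineConf_eq_iff z).2 hz)

lemma collapseLabel_inl_of_not {s : ℕ} {z : L (EuclideanSpace ℝ (Fin s)) U × (Fin s → X)}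
    (hz : ¬ ∀ i, z.2 i ≠ pt) : collapseLabel (lineQuot pt s (Sum.inl z)) = none :=
  if_neg fun h ↦ hz ((rank_lineConf_eq_iff z).1 h)

/-- Classes of rank below s are all the basepoint, and a configuration of rank s is recovered from
its labels by `Conf.label_injective`. -/
lemma collapseLabel_injective {s : ℕ} :
    Function.Injective (collapseLabel (U := U) (pt := pt) (s := s)) := by
  have hn : ∀ {c : Conf U pt} (hc : c ∈ rankFiltration U pt s), c.rank ≠ s →
      (Quot.mk _ (Sum.inl ⟨c, hc⟩) : Collapse (rankFiltration U pt s) _) =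
        Quot.mk (CollapseRel _ (rankFiltration U pt ((s : ℤ) - 1))) (Sum.inr ()) := by
    intro c hc h
    have := mem_rankFiltration_iff.1 hc
    exact Quot.sound (CollapseRel.collapse _ (mem_rankFiltration_iff.2 (by dsimp only; omega)))
  rintro ⟨⟨c, hc⟩ | u⟩ ⟨⟨c', hc'⟩ | u'⟩ h
  · simp only [collapseLabel, Sum.elim_inl] at h
    split_ifs at h with h1 h2 h2
    · obtain rfl := Conf.label_injective (Option.some.inj h)
      rfl
    · exact (hn hc h1).trans (hn hc' h2).symm
  · simp only [collapseLabel, Sum.elim_inl, Sum.elim_inr] at h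
    split_ifs at h with h1
    exact hn hc h1
  · simp only [collapseLabel, Sum.elim_inl, Sum.elim_inr] at h
    split_ifs at h with h1
    exact (hn hc' h1).symm
  · rfl

end Lines

/-! ### The subquotients of the rank filtration as quotients of spaces of configurations of lines -/

section Topology

variable {U : Type*} [NormedAddCommGroup U] [InnerProductSpace ℝ U] {X : Type*}
  [TopologicalSpace X] (pt : X)

lemma isQuotientMap_ofFrame (k : ℕ) :
    IsQuotientMap (fun p : Σ m : Fin k → ℕ, L (EuclideanSpace ℝ (Σ i, Fin (m i))) U ↦
      OrthTuple.ofFrame p.1 p.2.iso) where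
  surjective V := by
    obtain ⟨m, f, h⟩ := V.exists_ofFrame_eq
    exact ⟨⟨m, f⟩, h⟩
  eq_coinduced := rfl

/-- The configuration that is spanned by a frame. -/
def frameConf {k : ℕ} (m : Fin k → ℕ)
    (p : L (EuclideanSpace ℝ (Σ i, Fin (m i))) U × (Fin k → X)) : Conf U pt :=
  Conf.mk pt (OrthTuple.ofFrame m p.1.iso) p.2

lemma continuous_frameConf {k : ℕ} (m : Fin k → ℕ) :
    Continuous (frameConf (U := U) pt m) := by
  have h1 : Continuous fun p : L (EuclideanSpace ℝ (Σ i, Fin (m i))) U × (Fin k → X) ↦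
      (OrthTuple.ofFrame m p.1.iso, p.2) :=
    ((isQuotientMap_ofFrame k).continuous.comp
      (continuous_sigmaMk.comp continuous_fst)).prodMk continuous_snd
  exact (continuous_quot_mk.comp (continuous_sigmaMk (σ := fun k ↦ OrthTuple U k × (Fin k → X)))).comp
    h1

lemma continuous_lineConf (s : ℕ) : Continuous (lineConf (U := U) pt (s := s)) :=
  (continuous_frameConf pt fun _ ↦ 1).comp
    ((L.continuous_comp_right (reindexIsometry (sigmaFinOne s))).prodMap continuous_id)

variable {pt}

/-- The topology of the space of configurations is determined by the spaces of frames. -/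
lemma isClosed_of_frameConf [∀ k, LocallyCompactSpace (Fin k → X)] {D : Set (Conf U pt)}
    (h : ∀ (k : ℕ) (m : Fin k → ℕ), IsClosed (frameConf pt m ⁻¹' D)) : IsClosed D := by
  refine isQuotientMap_quot_mk.isClosed_preimage.1 (isClosed_sigma_iff.2 fun k ↦ ?_)
  -- Openness of the complement is continuity of a map to the Sierpiński space `Prop`. In this form
  -- it descends along the product of a quotient map with a locally compact space.
  refine isOpen_compl_iff.1 (continuous_Prop.1 ?_)
  refine (isQuotientMap_ofFrame k).continuous_lift_prod_left ?_
  refine (Homeomorph.sigmaProdDistrib (X := fun m : Fin k → ℕ ↦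
    L (EuclideanSpace ℝ (Σ i, Fin (m i))) U) (Y := Fin k → X)).symm.comp_continuous_iff'.1 ?_
  exact continuous_sigma_iff.2 fun m ↦ continuous_Prop.2 (h k m).isOpen_compl

lemma continuous_lineQuot (s : ℕ) : Continuous (lineQuot (U := U) pt s) :=
  continuous_sum_dom.2
    ⟨continuous_quot_mk.comp (continuous_inl.comp ((continuous_lineConf pt s).subtype_mk _)),
      continuous_quot_mk.comp continuous_inr⟩

/-- On the frames whose points are trivial outside of `T`, the map to `R^s / R^(s-1)` lifts to
configurations of lines. -/
lemma exists_lift_frameConf {k s : ℕ} (m : Fin k → ℕ) (T : Finset (Fin k))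
    (hT : ∑ i ∈ T, m i ≤ s) :
    ∃ h : L (EuclideanSpace ℝ (Σ i, Fin (m i))) U × (Fin k → X) →
        (L (EuclideanSpace ℝ (Fin s)) U × (Fin s → X)) ⊕ Unit,
      Continuous h ∧ ∀ p, (∀ i ∉ T, p.2 i = pt) →
        ∃ hp : frameConf pt m p ∈ rankFiltration U pt s,
          lineQuot pt s (h p) = Quot.mk _ (Sum.inl ⟨frameConf pt m p, hp⟩) := by
  classical
  -- If the blocks in `T` have total dimension below s, everything lands in the basepoint. Otherwise
  -- they have exactly s basis vectors, which form the lines.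
  rcases hT.lt_or_eq with hT | hT
  · refine ⟨fun _ ↦ Sum.inr (), continuous_const, fun p hp ↦ ?_⟩
    have hr : (frameConf pt m p).rank < s := by
      refine lt_of_le_of_lt ?_ hT
      refine (Conf.rank_ofFrame m p.1.iso p.2).trans_le ?_
      refine Finset.sum_le_sum_of_subset fun i hi ↦ ?_
      by_contra h
      exact (Finset.mem_filter.1 hi).2 (hp i h)
    exact ⟨mem_rankFiltration_iff.2 (by omega), lineQuot_inr_eq_mk hr _⟩
  · obtain ⟨ε, hε⟩ := exists_blockIndex m T hT
    refine ⟨fun p ↦ Sum.inl (p.1.precomp (reindexIsometry ε), fun i ↦ p.2 (ε i).1), ?_,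
      fun p hp ↦ ?_⟩
    · refine continuous_inl.comp (((L.continuous_comp_right _).comp continuous_fst).prodMk ?_)
      exact continuous_pi fun i ↦ (continuous_apply _).comp continuous_snd
    · have h := lineConf_precomp m T ε hε p.1 p.2 hp
      have hc : frameConf pt m p ∈ rankFiltration U pt s :=
        mem_rankFiltration_iff.2 (by
          have := rank_lineConf_le (pt := pt) (p.1.precomp (reindexIsometry ε), fun i ↦ p.2 (ε i).1)
          rw [h] at this
          exact_mod_cast this)
      exact ⟨hc, lineQuot_eq_mk _ h hc⟩

/-- There is no continuous lift on all frames, because the blocks that count change when points run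
into `pt`. There is one on each of the closed sets given by a choice of `T`, and finitely many of
these cover the configurations of rank at most s. -/
lemma isQuotientMap_lineQuot [T1Space X] [∀ k, LocallyCompactSpace (Fin k → X)] (s : ℕ) :
    IsQuotientMap (lineQuot (U := U) pt s) := by
  classical
  refine isQuotientMap_iff_isClosed.2 ⟨lineQuot_surjective s, fun D ↦
    ⟨fun hD ↦ hD.preimage (continuous_lineQuot s), fun hD ↦ ?_⟩⟩
  refine isQuotientMap_quot_mk.isClosed_preimage.1
    (isClosed_sum_iff.2 ⟨?_, isClosed_discrete _⟩)
  let D' : Set (Conf U pt) := {c | ∃ hc : c ∈ rankFiltration U pt s,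
    (Quot.mk _ (Sum.inl ⟨c, hc⟩) : Collapse (rankFiltration U pt s) _) ∈ D}
  -- It is enough that the set is closed in the whole configuration space, where the frame test is
  -- available.
  suffices hD' : IsClosed D' by
    convert hD'.preimage (continuous_subtype_val (p := (· ∈ rankFiltration U pt s))) using 1
    ext c
    exact ⟨fun h ↦ ⟨c.2, h⟩, fun h ↦ h.2⟩
  refine isClosed_of_frameConf fun k m ↦ ?_
  choose h hc hh using fun T : {T : Finset (Fin k) // ∑ i ∈ T, m i ≤ s} ↦
    exists_lift_frameConf (U := U) (pt := pt) m T.1 T.2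
  have hE : frameConf pt m ⁻¹' D' = ⋃ T : {T : Finset (Fin k) // ∑ i ∈ T, m i ≤ s},
      {p | ∀ i ∉ T.1, p.2 i = pt} ∩ h T ⁻¹' (lineQuot pt s ⁻¹' D) := by
    ext p
    simp only [Set.mem_iUnion]
    constructor
    · rintro ⟨hp, hD⟩
      have hr := (Conf.rank_ofFrame (pt := pt) m p.1.iso p.2).symm.trans_le
        (by exact_mod_cast mem_rankFiltration_iff.1 hp)
      -- The set `T` is the set of indices with point off the basepoint; its total dimension is the
      -- rank.
      refine ⟨⟨_, hr⟩, ?_⟩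
      have hT : ∀ i ∉ Finset.univ.filter (fun i ↦ p.2 i ≠ pt), p.2 i = pt := by simp
      refine ⟨hT, ?_⟩
      obtain ⟨_, hq⟩ := hh ⟨_, hr⟩ p hT
      rw [Set.mem_preimage, Set.mem_preimage, hq]
      exact hD
    · rintro ⟨T, hT, hD⟩
      obtain ⟨hp, hq⟩ := hh T p hT
      refine ⟨hp, ?_⟩
      rw [← hq]
      exact hD
  rw [hE]
  refine isClosed_iUnion_of_finite fun T ↦ IsClosed.inter ?_ (hD.preimage (hc T))
  simp only [Set.ofPred_forall]
  exact isClosed_iInter fun i ↦ isClosed_iInter fun _ ↦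
    isClosed_singleton.preimage ((continuous_apply i).comp continuous_snd)

end Topology

/-! ### Tuples of diagonal matrices -/

section Diagonal

variable {n s : ℕ}

/-- An orthogonal matrix has entries in [-1, 1]. Compactness is what makes (g, y) ↦ g diag(y) g⁻¹
proper, and it supplies the local compactness needed in `L.continuous_precomp`. -/
instance : CompactSpace (Matrix.orthogonalGroup (Fin s) ℝ) := by
  have hK : IsCompact (Set.univ.pi fun _ : Fin s ↦ Set.univ.pi fun _ : Fin s ↦
      Set.Icc (-1 : ℝ) 1) :=
    isCompact_univ_pi fun _ ↦ isCompact_univ_pi fun _ ↦ isCompact_Icc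
  refine isCompact_iff_compactSpace.1 (IsCompact.of_isClosed_subset
    (s := (Set.univ.pi fun _ : Fin s ↦ Set.univ.pi fun _ : Fin s ↦ Set.Icc (-1 : ℝ) 1 :
      Set (Matrix (Fin s) (Fin s) ℝ))) hK ?_ ?_)
  · have : (Matrix.orthogonalGroup (Fin s) ℝ : Set (Matrix (Fin s) (Fin s) ℝ)) =
        {A | A.transpose * A = 1} := by
      ext A
      exact Matrix.mem_orthogonalGroup_iff' (Fin s) ℝ
    rw [this]
    exact isClosed_eq (by fun_prop) continuous_const
  · intro A hA i _ j _
    exact abs_le.1 (entry_norm_bound_of_unitary hA i j)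

/-- This makes the one-point compactification of `CommSym n s` Hausdorff. -/
instance : LocallyCompactSpace (CommSym n s) := by
  have : LocallyCompactSpace (Fin n → Matrix (Fin s) (Fin s) ℝ) :=
    inferInstanceAs (LocallyCompactSpace (Fin n → Fin s → Fin s → ℝ))
  refine IsClosed.locallyCompactSpace (X := Fin n → Matrix (Fin s) (Fin s) ℝ)
    (s := {X | (∀ i, (X i).IsSymm) ∧ ∀ i j, Commute (X i) (X j)}) ?_
  simp only [Matrix.IsSymm, Commute, SemiconjBy, Set.ofPred_and, Set.ofPred_forall]
  refine IsClosed.inter (isClosed_iInter fun i ↦ isClosed_eq (by fun_prop) (by fun_prop))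
    (isClosed_iInter fun i ↦ isClosed_iInter fun j ↦ isClosed_eq (by fun_prop) (by fun_prop))

/-- The tuple of diagonal matrices whose joint eigenvalue on `e_i` is `y i`. -/
def diagTuple (y : Fin s → EuclideanSpace ℝ (Fin n)) : CommSym n s :=
  ⟨fun j ↦ Matrix.diagonal fun i ↦ y i j, fun _ ↦ Matrix.isSymm_diagonal _,
    fun _ _ ↦ Matrix.commute_diagonal _ _⟩

/-- The coordinates of a point of the sphere other than the basepoint. -/
def finitePart (x : Sphere n) : EuclideanSpace ℝ (Fin n) := x.elim 0 id

open Classical in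
/-- The extension of `diagTuple` to the one-point compactifications. -/
def diagPoint (x : Fin s → Sphere n) : OnePoint (CommSym n s) :=
  -- The default value 0 of `finitePart` at ∞ is never used in this branch.
  if ∀ i, x i ≠ ∞ then ((diagTuple fun i ↦ finitePart (x i) : CommSym n s) : OnePoint _) else ∞

lemma diagPoint_coe (y : Fin s → EuclideanSpace ℝ (Fin n)) :
    diagPoint (fun i ↦ (y i : Sphere n)) = (diagTuple y : OnePoint (CommSym n s)) :=
  if_pos fun _ ↦ OnePoint.coe_ne_infty _

lemma diagPoint_of_not {x : Fin s → Sphere n} (hx : ¬ ∀ i, x i ≠ ∞) : diagPoint x = ∞ := if_neg hx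

lemma exists_eq_coe {x : Fin s → Sphere n} (hx : ∀ i, x i ≠ ∞) :
    ∃ y : Fin s → EuclideanSpace ℝ (Fin n), x = fun i ↦ (y i : Sphere n) := by
  choose y hy using fun i ↦ OnePoint.ne_infty_iff_exists.1 (hx i)
  exact ⟨y, funext fun i ↦ (hy i).symm⟩

lemma conj_one (X : CommSym n s) : conj 1 X = X := by
  apply Subtype.ext
  funext j
  simp [conj]

lemma continuous_conj :
    Continuous fun p : Matrix.orthogonalGroup (Fin s) ℝ × CommSym n s ↦ conj p.1 p.2 := by
  refine Continuous.subtype_mk (continuous_pi fun j ↦ ?_) _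
  have h1 : Continuous fun p : Matrix.orthogonalGroup (Fin s) ℝ × CommSym n s ↦ p.1.1 :=
    continuous_subtype_val.comp continuous_fst
  have h2 : Continuous fun p : Matrix.orthogonalGroup (Fin s) ℝ × CommSym n s ↦ p.2.1 j :=
    (continuous_apply j).comp (continuous_subtype_val.comp continuous_snd)
  exact (h1.matrix_mul h2).matrix_mul h1.matrix_transpose

lemma continuous_diagTuple : Continuous (diagTuple (n := n) (s := s)) := by
  refine Continuous.subtype_mk (continuous_pi fun j ↦ ?_) _
  fun_prop

/-- The matrices with given eigenvectors and eigenvalues. -/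
def conjDiag (p : Matrix.orthogonalGroup (Fin s) ℝ × (Fin s → Sphere n)) :
    OnePoint (CommSym n s) :=
  (diagPoint p.2).map (conj p.1)

lemma conjDiag_preimage (S : Set (CommSym n s)) :
    conjDiag ⁻¹' (((↑) : CommSym n s → OnePoint (CommSym n s)) '' S) =
      Prod.map id (Pi.map fun _ ↦ ((↑) : EuclideanSpace ℝ (Fin n) → Sphere n)) ''
      {p : Matrix.orthogonalGroup (Fin s) ℝ × (Fin s → EuclideanSpace ℝ (Fin n)) |
        conj p.1 (diagTuple p.2) ∈ S} := by
  ext ⟨g, x⟩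
  by_cases hx : ∀ i, x i ≠ ∞
  · obtain ⟨y, rfl⟩ := exists_eq_coe hx
    constructor
    · rintro ⟨X, hX, h⟩
      rw [conjDiag, diagPoint_coe, OnePoint.map_some] at h
      refine ⟨(g, y), ?_, rfl⟩
      rw [OnePoint.coe_injective h] at hX
      exact hX
    · rintro ⟨⟨g', y'⟩, h, h'⟩
      obtain ⟨rfl, h2⟩ := Prod.mk.inj h'
      obtain rfl : y' = y := funext fun i ↦ OnePoint.coe_injective (congrFun h2 i)
      refine ⟨_, h, ?_⟩
      rw [conjDiag, diagPoint_coe, OnePoint.map_some]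
      rfl
  · constructor
    · rintro ⟨X, _, h⟩
      rw [conjDiag, diagPoint_of_not hx, OnePoint.map_infty] at h
      exact absurd h (OnePoint.coe_ne_infty _)
    · rintro ⟨⟨g', y'⟩, _, h'⟩
      refine absurd (fun i ↦ ?_) hx
      rw [← (Prod.mk.inj h').2]
      exact OnePoint.coe_ne_infty _

/-- The `i`-th diagonal entries of the matrices `gᵀ (X j) g`. -/
def conjDiagEntry (i : Fin s) (p : Matrix.orthogonalGroup (Fin s) ℝ × CommSym n s) :
    EuclideanSpace ℝ (Fin n) :=
  WithLp.toLp 2 fun j ↦ (p.1.1.transpose * p.2.1 j * p.1.1) i i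

lemma continuous_conjDiagEntry (i : Fin s) : Continuous (conjDiagEntry (n := n) i) := by
  refine (PiLp.continuous_toLp 2 _).comp (continuous_pi fun j ↦ ?_)
  have h1 : Continuous fun p : Matrix.orthogonalGroup (Fin s) ℝ × CommSym n s ↦ p.1.1 :=
    continuous_subtype_val.comp continuous_fst
  have h2 : Continuous fun p : Matrix.orthogonalGroup (Fin s) ℝ × CommSym n s ↦ p.2.1 j :=
    (continuous_apply j).comp (continuous_subtype_val.comp continuous_snd)
  exact ((h1.matrix_transpose.matrix_mul h2).matrix_mul h1).matrix_elem i i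

lemma conjDiagEntry_conj (i : Fin s) (g : Matrix.orthogonalGroup (Fin s) ℝ)
    (y : Fin s → EuclideanSpace ℝ (Fin n)) :
    conjDiagEntry i (g, conj g (diagTuple y)) = y i := by
  have hg : g.1.transpose * g.1 = 1 := (Matrix.mem_orthogonalGroup_iff' (Fin s) ℝ).1 g.2
  ext j
  change (g.1.transpose * (g.1 * Matrix.diagonal (fun i ↦ y i j) * g.1.transpose) * g.1) i i = _
  rw [Matrix.mul_assoc, Matrix.mul_assoc _ _ g.1, hg, Matrix.mul_one, ← Matrix.mul_assoc, hg,
    Matrix.one_mul, Matrix.diagonal_apply_eq]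

lemma continuous_conj_diagTuple :
    Continuous fun p : Matrix.orthogonalGroup (Fin s) ℝ × (Fin s → EuclideanSpace ℝ (Fin n)) ↦
      conj p.1 (diagTuple p.2) :=
  continuous_conj.comp (continuous_fst.prodMk (continuous_diagTuple.comp continuous_snd))

/-- The map `(g, y) ↦ g diag(y) g⁻¹` is proper. -/
lemma isCompact_conj_diagTuple_preimage {K : Set (CommSym n s)} (hK : IsClosed K)
    (hK' : IsCompact K) :
    IsCompact {p : Matrix.orthogonalGroup (Fin s) ℝ × (Fin s → EuclideanSpace ℝ (Fin n)) |
      conj p.1 (diagTuple p.2) ∈ K} := by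
  have hB : IsCompact ((Set.univ : Set (Matrix.orthogonalGroup (Fin s) ℝ)) ×ˢ
      Set.univ.pi fun i : Fin s ↦ conjDiagEntry i '' (Set.univ ×ˢ K)) :=
    isCompact_univ.prod (isCompact_univ_pi fun i ↦
      (isCompact_univ.prod hK').image (continuous_conjDiagEntry i))
  -- The eigenvalues y are recovered as the diagonal entries of gᵀ X g, so they range over a compact
  -- set when X ranges over `K` and g over O(s).
  refine hB.of_isClosed_subset (hK.preimage continuous_conj_diagTuple) ?_
  rintro ⟨g, y⟩ hp
  exact ⟨trivial, fun i _ ↦ ⟨(g, conj g (diagTuple y)), ⟨trivial, hp⟩, conjDiagEntry_conj i g y⟩⟩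

/-- Preimages of open sets of matrices are open because ℝ^n is open in S^n; preimages of compact
sets are compact by properness, hence closed. -/
lemma continuous_conjDiag : Continuous (conjDiag (n := n) (s := s)) := by
  refine continuous_onePoint_of (fun S hS ↦ ?_) fun K hK hK' ↦ ?_
  · rw [conjDiag_preimage]
    exact (IsOpenEmbedding.id.prodMap
      (IsOpenEmbedding.piMap fun _ ↦ OnePoint.isOpenEmbedding_coe)).isOpenMap _
        (hS.preimage continuous_conj_diagTuple)
  · rw [conjDiag_preimage]
    exact ((isCompact_conj_diagTuple_preimage hK hK').image (continuous_id.prodMap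
      (Continuous.piMap fun _ ↦ OnePoint.continuous_coe))).isClosed

lemma continuous_diagPoint : Continuous (diagPoint (n := n) (s := s)) := by
  have h := continuous_conjDiag.comp (Continuous.prodMk_right
    (Y := Fin s → Sphere n) (1 : Matrix.orthogonalGroup (Fin s) ℝ))
  convert h using 1
  funext x
  have h1 : (conj 1 : CommSym n s → CommSym n s) = id := funext conj_one
  simp [conjDiag, h1]

/-- Commuting symmetric matrices are simultaneously diagonalizable. -/
lemma exists_conj_diagTuple (X : CommSym n s) :
    ∃ (g : Matrix.orthogonalGroup (Fin s) ℝ) (y : Fin s → EuclideanSpace ℝ (Fin n)),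
      conj g (diagTuple y) = X := by
  classical
  let T : Fin n → Module.End ℝ (EuclideanSpace ℝ (Fin s)) := fun j ↦ Matrix.toEuclideanLin (X.1 j)
  have hT : ∀ j, (T j).IsSymmetric := fun j ↦
    Matrix.isSymmetric_toEuclideanLin_iff.2 (by
      have := X.2.1 j
      rwa [Matrix.IsHermitian, Matrix.conjTranspose_eq_transpose_of_trivial])
  have hC : Pairwise (Function.onFun Commute T) := by
    intro i j _
    ext1 v
    have := (X.2.2 i j).eq
    simp [T, Matrix.toLpLin_apply, Matrix.mulVec_mulVec, this]
  let V : (Fin n → ℝ) → Submodule ℝ (EuclideanSpace ℝ (Fin s)) :=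
    fun α ↦ ⨅ j, (T j).eigenspace (α j)
  have hI : DirectSum.IsInternal V :=
    LinearMap.IsSymmetric.directSum_isInternal_of_pairwise_commute hT hC
  have hO : OrthogonalFamily ℝ (fun α ↦ V α) fun α ↦ (V α).subtypeₗᵢ :=
    LinearMap.IsSymmetric.orthogonalFamily_iInf_eigenspaces hT
  -- The candidate joint eigenvalues form the infinite set ℝ^n. Only finitely many have a nonzero
  -- eigenspace, and an adapted orthonormal basis needs a finite index type.
  have hfin : {α | V α ≠ ⊥}.Finite :=
    WellFoundedGT.finite_ne_bot_of_iSupIndep hI.submodule_iSupIndep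
  have : Fintype {α // V α ≠ ⊥} := hfin.fintype
  have hI' : DirectSum.IsInternal fun α : {α // V α ≠ ⊥} ↦ V α :=
    DirectSum.isInternal_ne_bot_iff.2 hI
  have hO' := hO.comp (Subtype.val_injective (p := fun α ↦ V α ≠ ⊥))
  have hs : Module.finrank ℝ (EuclideanSpace ℝ (Fin s)) = s := by simp
  let b := hI'.subordinateOrthonormalBasis hs hO'
  let χ : Fin s → Fin n → ℝ := fun a ↦ (hI'.subordinateOrthonormalBasisIndex hs a hO').1
  have hb : ∀ a j, Matrix.mulVec (X.1 j) (b a) = χ a j • (b a : Fin s → ℝ) := by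
    intro a j
    have h := hI'.subordinateOrthonormalBasis_subordinate hs a hO'
    have h2 := Module.End.mem_eigenspace_iff.1 ((Submodule.mem_iInf _).1 h j)
    simpa [T, Matrix.toLpLin_apply] using congrArg WithLp.ofLp h2
  -- The columns are the joint eigenvectors.
  let M : Matrix (Fin s) (Fin s) ℝ := Matrix.of fun i a ↦ b a i
  have hM : M.transpose * M = 1 := by
    ext a c
    have := orthonormal_iff_ite.1 b.orthonormal c a
    rw [PiLp.inner_apply] at this
    simpa [Matrix.mul_apply, M, Matrix.one_apply, eq_comm] using this
  have hM' : M * M.transpose = 1 := mul_eq_one_comm.1 hM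
  refine ⟨⟨M, (Matrix.mem_orthogonalGroup_iff' _ _).2 hM⟩, fun a ↦ WithLp.toLp 2 (χ a), ?_⟩
  apply Subtype.ext
  funext j
  have hX : X.1 j * M = M * Matrix.diagonal fun a ↦ χ a j := by
    ext i a
    rw [Matrix.mul_diagonal]
    have := congrFun (hb a j) i
    simpa [Matrix.mulVec, dotProduct, Matrix.mul_apply, M, mul_comm] using this
  change M * Matrix.diagonal (fun a ↦ χ a j) * M.transpose = X.1 j
  rw [← hX, Matrix.mul_assoc, hM', Matrix.mul_one]

end Diagonal

/-! ### The half-smash product as a quotient of the space of configurations of lines -/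

section HalfSmash

variable {n s : ℕ}

lemma orthIsometry_apply (g : Matrix.orthogonalGroup (Fin s) ℝ) (v : EuclideanSpace ℝ (Fin s)) :
    orthIsometry g v = WithLp.toLp 2 (Matrix.mulVec g.1 v) := rfl

lemma continuous_orthIsometry :
    Continuous fun g : Matrix.orthogonalGroup (Fin s) ℝ ↦
      (orthIsometry g).toContinuousLinearMap := by
  let F : Matrix (Fin s) (Fin s) ℝ →ₗ[ℝ]
      EuclideanSpace ℝ (Fin s) →L[ℝ] EuclideanSpace ℝ (Fin s) :=
    LinearMap.toContinuousLinearMap.toLinearMap ∘ₗ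
      (Matrix.toEuclideanLin : Matrix (Fin s) (Fin s) ℝ ≃ₗ[ℝ] _).toLinearMap
  exact F.continuous_of_finiteDimensional.comp continuous_subtype_val

/-- The map from configurations of `s` lines, with a disjoint basepoint, to the half-smash
product. -/
def smashQuot (n s : ℕ) :
    (L (EuclideanSpace ℝ (Fin s)) (SymSpace n) × (Fin s → Sphere n)) ⊕ Unit → HalfSmash n s :=
  Sum.elim (fun z ↦ HalfSmash.mk (diagPoint z.2) (Sum.inl z.1)) fun _ ↦ HalfSmash.base n s

lemma HalfSmash.mk_inr (X : OnePoint (CommSym n s)) (u : Unit) :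
    HalfSmash.mk X (Sum.inr u) = HalfSmash.base n s :=
  Quot.sound (SmashRel.wedge (Or.inr rfl) (Or.inr rfl))

lemma HalfSmash.mk_infty (y : L (EuclideanSpace ℝ (Fin s)) (SymSpace n) ⊕ Unit) :
    HalfSmash.mk ∞ y = HalfSmash.base n s :=
  Quot.sound (SmashRel.wedge (Or.inl rfl) (Or.inr rfl))

lemma HalfSmash.mk_conj (g : Matrix.orthogonalGroup (Fin s) ℝ) (X : OnePoint (CommSym n s))
    (f : L (EuclideanSpace ℝ (Fin s)) (SymSpace n)) :
    HalfSmash.mk (X.map (conj g)) (Sum.inl f) =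
      HalfSmash.mk X (Sum.inl (f.precomp (orthIsometry g))) :=
  (Quot.sound (SmashRel.balance g X f)).symm

/-- The map to `C_n(𝔰𝔶𝔪_s)⁺` from pairs of eigenvectors and eigenvalues; the additional point is
needed for `s = 0`. -/
def conjDiagPlus : (Matrix.orthogonalGroup (Fin s) ℝ × (Fin s → Sphere n)) ⊕ Unit →
    OnePoint (CommSym n s) :=
  Sum.elim conjDiag fun _ ↦ ∞

lemma conjDiagPlus_surjective : Function.Surjective (conjDiagPlus (n := n) (s := s)) := by
  intro X
  induction X using OnePoint.rec with
  | infty => exact ⟨Sum.inr (), rfl⟩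
  | coe X =>
    obtain ⟨g, y, rfl⟩ := exists_conj_diagTuple X
    refine ⟨Sum.inl (g, fun i ↦ (y i : Sphere n)), ?_⟩
    simp [conjDiagPlus, conjDiag, diagPoint_coe]

/-- Products of quotient maps need not be quotient maps, but a map from a compact space to a
Hausdorff space is proper, and properness survives the product with any `Y`. -/
lemma isQuotientMap_conjDiagPlus_prod (Y : Type*) [TopologicalSpace Y] :
    IsQuotientMap (Prod.map (conjDiagPlus (n := n) (s := s)) (id : Y → Y)) := by
  have hc : Continuous (conjDiagPlus (n := n) (s := s)) :=
    continuous_sum_dom.2 ⟨continuous_conjDiag, continuous_const⟩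
  have hp := hc.isProperMap.prodMap (isProperMap_id (X := Y))
  exact hp.isClosedMap.isQuotientMap hp.continuous
    (conjDiagPlus_surjective.prodMap Function.surjective_id)

/-- The lift of `conjDiagPlus` to configurations of lines. -/
def absorbEigenvectors
    (p : ((Matrix.orthogonalGroup (Fin s) ℝ × (Fin s → Sphere n)) ⊕ Unit) ×
      L (EuclideanSpace ℝ (Fin s)) (SymSpace n)) :
    (L (EuclideanSpace ℝ (Fin s)) (SymSpace n) × (Fin s → Sphere n)) ⊕ Unit :=
  Sum.map (fun q ↦ (q.2.precomp (orthIsometry q.1.1), q.1.2)) (fun _ ↦ ())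
    (Homeomorph.sumProdDistrib p)

lemma continuous_absorbEigenvectors : Continuous (absorbEigenvectors (n := n) (s := s)) := by
  refine Continuous.comp (Continuous.sumMap ?_ continuous_const) (Homeomorph.continuous _)
  refine Continuous.prodMk ?_ (continuous_snd.comp continuous_fst)
  exact (L.continuous_precomp _ continuous_orthIsometry).comp
    (continuous_snd.prodMk (continuous_fst.comp continuous_fst))

lemma smashQuot_absorbEigenvectors
    (p : ((Matrix.orthogonalGroup (Fin s) ℝ × (Fin s → Sphere n)) ⊕ Unit) ×
      L (EuclideanSpace ℝ (Fin s)) (SymSpace n)) :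
    smashQuot n s (absorbEigenvectors p) = HalfSmash.mk (conjDiagPlus p.1) (Sum.inl p.2) := by
  obtain ⟨⟨g, x⟩ | u, f⟩ := p
  · exact (HalfSmash.mk_conj g _ f).symm
  · exact (HalfSmash.mk_infty _).symm

lemma continuous_smashQuot : Continuous (smashQuot n s) := by
  refine continuous_sum_dom.2 ⟨?_, continuous_const⟩
  exact continuous_quot_mk.comp
    ((continuous_diagPoint.comp continuous_snd).prodMk (continuous_inl.comp continuous_fst))

lemma smashQuot_surjective : Function.Surjective (smashQuot n s) := by
  intro z
  induction z using HalfSmash.cases with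
  | hl X f =>
    obtain ⟨a, rfl⟩ := conjDiagPlus_surjective X
    exact ⟨_, smashQuot_absorbEigenvectors (a, f)⟩
  | hr X => exact ⟨Sum.inr (), (HalfSmash.mk_inr _ _).symm⟩

/-- By `smashQuot_absorbEigenvectors`, diagonalizing X and absorbing the eigenvectors into the
embedding gives a continuous map to the space of line configurations. A closed preimage there pulls
back to a closed set upstairs, which descends along `isQuotientMap_conjDiagPlus_prod`. -/
lemma isQuotientMap_smashQuot : IsQuotientMap (smashQuot n s) := by
  refine isQuotientMap_iff_isClosed.2 ⟨smashQuot_surjective, fun D ↦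
    ⟨fun hD ↦ hD.preimage continuous_smashQuot, fun hD ↦ ?_⟩⟩
  refine isQuotientMap_quot_mk.isClosed_preimage.1 ?_
  refine Homeomorph.prodSumDistrib.symm.isClosed_preimage.1 (isClosed_sum_iff.2 ⟨?_, ?_⟩)
  · refine (isQuotientMap_conjDiagPlus_prod _).isClosed_preimage.1 ?_
    convert hD.preimage continuous_absorbEigenvectors using 1
    ext p
    exact iff_of_eq (congrArg (· ∈ D) (smashQuot_absorbEigenvectors p).symm)
  · have h : IsClosed ((fun _ : OnePoint (CommSym n s) × Unit ↦ HalfSmash.base n s) ⁻¹' D) := by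
      by_cases h : HalfSmash.base n s ∈ D <;> simp [h]
    convert h using 1
    ext p
    change HalfSmash.mk p.1 (Sum.inr p.2) ∈ D ↔ _
    rw [HalfSmash.mk_inr]
    rfl

end HalfSmash

/-! ### Joint eigenspaces -/

section Label

variable {n s : ℕ}

/-- The joint eigenspace of a tuple of commuting matrices. -/
def jointEigenspace (X : CommSym n s) (y : EuclideanSpace ℝ (Fin n)) :
    Submodule ℝ (EuclideanSpace ℝ (Fin s)) where
  carrier := {v | ∀ j, Matrix.mulVec (X.1 j) v = y j • (v : Fin s → ℝ)}
  add_mem' hv hw j := by simp [Matrix.mulVec_add, hv j, hw j]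
  zero_mem' j := by simp
  smul_mem' c v hv j := by
    rw [WithLp.ofLp_smul, Matrix.mulVec_smul, hv j, smul_comm]

/-- If v is an eigenvector of X, then gv is one of gXg⁻¹ for the same eigenvalue. Hence the image of
the eigenspaces in Sym(ℝ^n) respects the relation `SmashRel.balance`. -/
lemma jointEigenspace_conj (g : Matrix.orthogonalGroup (Fin s) ℝ) (X : CommSym n s)
    (y : EuclideanSpace ℝ (Fin n)) :
    jointEigenspace (conj g X) y = (jointEigenspace X y).map (orthIsometry g).toLinearMap := by
  have hg : g.1.transpose * g.1 = 1 := (Matrix.mem_orthogonalGroup_iff' (Fin s) ℝ).1 g.2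
  have hg' : g.1 * g.1.transpose = 1 := (Matrix.mem_orthogonalGroup_iff (Fin s) ℝ).1 g.2
  ext v
  constructor
  · intro hv
    refine ⟨WithLp.toLp 2 (Matrix.mulVec g.1.transpose v), fun j ↦ ?_, ?_⟩
    · have := congrArg (Matrix.mulVec g.1.transpose) (hv j)
      simp only [conj, Matrix.mulVec_mulVec, Matrix.mulVec_smul, ← Matrix.mul_assoc, hg,
        Matrix.one_mul] at this
      simpa [Matrix.mulVec_mulVec] using this
    · change orthIsometry g _ = v
      rw [orthIsometry_apply]
      simp [Matrix.mulVec_mulVec, hg']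
  · rintro ⟨u, hu, rfl⟩ j
    change Matrix.mulVec (g.1 * X.1 j * g.1.transpose) (Matrix.mulVec g.1 u) =
      y j • Matrix.mulVec g.1 u
    rw [Matrix.mulVec_mulVec, Matrix.mul_assoc, hg, Matrix.mul_one, ← Matrix.mulVec_mulVec, hu j,
      Matrix.mulVec_smul]

lemma jointEigenspace_diagTuple (x : Fin s → EuclideanSpace ℝ (Fin n))
    (y : EuclideanSpace ℝ (Fin n)) :
    jointEigenspace (diagTuple x) y =
      Submodule.span ℝ ((fun i ↦ EuclideanSpace.single i (1 : ℝ)) '' {i | x i = y}) := by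
  ext v
  rw [mem_span_single_iff]
  constructor
  · intro hv i hi
    obtain ⟨j, hj⟩ : ∃ j, x i j ≠ y j := by
      by_contra! h
      exact hi (PiLp.ext h)
    have := congrFun (hv j) i
    simp only [diagTuple, Matrix.mulVec_diagonal, Pi.smul_apply, smul_eq_mul] at this
    have h2 : (x i j - y j) * v i = 0 := by rw [sub_mul, this, sub_self]
    exact (mul_eq_zero.1 h2).resolve_left (sub_ne_zero.2 hj)
  · intro hv j
    funext i
    simp only [diagTuple, Matrix.mulVec_diagonal, Pi.smul_apply, smul_eq_mul]
    by_cases hi : x i = y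
    · rw [hi]
    · rw [hv i hi, mul_zero, mul_zero]

/-- The images of the joint eigenspaces, for a point of the half-smash product other than the
basepoint. -/
def smashLabel : HalfSmash n s → Option ({y : Sphere n // y ≠ ∞} → Submodule ℝ (SymSpace n)) :=
  Quot.lift (fun p ↦ p.1.elim none fun X ↦ p.2.elim
    (fun f ↦ some fun y ↦ (jointEigenspace X (finitePart y.1)).map f.iso.toLinearMap)
    fun _ ↦ none) (by
      rintro _ _ (⟨ha, hb⟩ | ⟨g, X, f⟩)
      · have key : ∀ a : OnePoint (CommSym n s) ×
            (L (EuclideanSpace ℝ (Fin s)) (SymSpace n) ⊕ Unit),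
            (a.1 = ∞ ∨ a.2 = Sum.inr ()) → a.1.elim none (fun X ↦ a.2.elim
            (fun f ↦ some fun y : {y : Sphere n // y ≠ ∞} ↦
              (jointEigenspace X (finitePart y.1)).map f.iso.toLinearMap) fun _ ↦ none) = none := by
          rintro ⟨X, y⟩ (rfl | rfl)
          · rfl
          · induction X using OnePoint.rec <;> rfl
        rw [key _ ha, key _ hb]
      · induction X using OnePoint.rec with
        | infty => rfl
        | coe X =>
          refine congrArg some (funext fun y ↦ ?_)
          change _ = (jointEigenspace (conj g X) (finitePart y.1)).map f.toLinearMap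
          rw [jointEigenspace_conj]
          exact Submodule.map_comp _ _ _)

lemma smashLabel_inl {z : L (EuclideanSpace ℝ (Fin s)) (SymSpace n) × (Fin s → Sphere n)}
    (hz : ∀ i, z.2 i ≠ ∞) :
    smashLabel (smashQuot n s (Sum.inl z)) = some (lineConf ∞ z).label := by
  obtain ⟨f, x⟩ := z
  obtain ⟨x, rfl⟩ := exists_eq_coe hz
  change smashLabel (HalfSmash.mk (diagPoint fun i ↦ (x i : Sphere n)) (Sum.inl f)) = _
  rw [diagPoint_coe]
  refine congrArg some (funext fun ⟨y, hy⟩ ↦ ?_)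
  obtain ⟨y, rfl⟩ := OnePoint.ne_infty_iff_exists.1 hy
  rw [label_lineConf]
  change (jointEigenspace (diagTuple x) y).map f.iso.toLinearMap = _
  rw [jointEigenspace_diagTuple, Submodule.map_span, Set.image_image]
  simp

lemma smashQuot_inl_of_not
    {z : L (EuclideanSpace ℝ (Fin s)) (SymSpace n) × (Fin s → Sphere n)}
    (hz : ¬ ∀ i, z.2 i ≠ ∞) : smashQuot n s (Sum.inl z) = HalfSmash.base n s := by
  change HalfSmash.mk (diagPoint z.2) _ = _
  rw [diagPoint_of_not hz, HalfSmash.mk_infty]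

/-- Two frames with equal labels differ by an orthogonal change of basis that only mixes vectors
attached to the same point. This matrix carries one diagonal tuple to the other, so the two classes
agree by balancing. -/
lemma smashQuot_eq_of_label
    {z z' : L (EuclideanSpace ℝ (Fin s)) (SymSpace n) × (Fin s → Sphere n)}
    (hz : ∀ i, z.2 i ≠ ∞) (hz' : ∀ i, z'.2 i ≠ ∞)
    (h : (lineConf ∞ z).label = (lineConf ∞ z').label) :
    smashQuot n s (Sum.inl z) = smashQuot n s (Sum.inl z') := by
  obtain ⟨f, x⟩ := z
  obtain ⟨f', x'⟩ := z'
  obtain ⟨x, rfl⟩ := exists_eq_coe hz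
  obtain ⟨x', rfl⟩ := exists_eq_coe hz'
  -- The vector f'(e_k) lies in the label at x'_k, which is spanned by the f(e_i) with x_i = x'_k.
  -- Its coordinates v in the frame f therefore vanish at all other i.
  have hv : ∀ k, ∃ v : EuclideanSpace ℝ (Fin s), f.iso v = f'.iso (EuclideanSpace.single k 1) ∧
      ∀ i, x i ≠ x' k → v i = 0 := by
    intro k
    have h1 := congrFun h ⟨(x' k : Sphere n), OnePoint.coe_ne_infty _⟩
    rw [label_lineConf, label_lineConf] at h1
    have h2 : f'.iso (EuclideanSpace.single k 1) ∈ Submodule.span ℝ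
        ((fun i ↦ f.iso (EuclideanSpace.single i 1)) '' {i | (x i : Sphere n) = x' k}) := by
      rw [h1]
      exact Submodule.subset_span ⟨k, rfl, rfl⟩
    have h3 : Submodule.span ℝ
        ((fun i ↦ f.iso (EuclideanSpace.single i 1)) '' {i | (x i : Sphere n) = x' k}) =
        (Submodule.span ℝ ((fun i ↦ EuclideanSpace.single i (1 : ℝ)) ''
          {i | (x i : Sphere n) = x' k})).map f.iso.toLinearMap := by
      rw [Submodule.map_span, Set.image_image]
      rfl
    rw [h3] at h2
    obtain ⟨v, hv, hv'⟩ := h2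
    exact ⟨v, hv', fun i hi ↦ (mem_span_single_iff _ v).1 hv i fun h ↦
      hi (OnePoint.coe_injective h)⟩
  choose v hv hv0 using hv
  let M : Matrix (Fin s) (Fin s) ℝ := Matrix.of fun i k ↦ v k i
  have hM : M.transpose * M = 1 := by
    ext a c
    have h1 : inner ℝ (v c) (v a) = if c = a then 1 else 0 := by
      rw [← f.iso.inner_map_map, hv, hv]
      exact orthonormal_iff_ite.1 (orthonormal_comp_single f'.iso) c a
    rw [PiLp.inner_apply] at h1
    simpa [Matrix.mul_apply, M, Matrix.one_apply, eq_comm] using h1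
  have hM' : M * M.transpose = 1 := mul_eq_one_comm.1 hM
  let g : Matrix.orthogonalGroup (Fin s) ℝ := ⟨M, (Matrix.mem_orthogonalGroup_iff' _ _).2 hM⟩
  have hf : f.precomp (orthIsometry g) = f' := by
    refine isometry_ext (f := (f.precomp (orthIsometry g)).iso) (g := f'.iso) fun k ↦ ?_
    rw [L.precomp_apply, ← hv, orthIsometry_apply]
    congr 1
    ext i
    simp [g, M]
  have hx : conj g (diagTuple x') = diagTuple x := by
    apply Subtype.ext
    funext j
    -- An entry M_ik can be nonzero only if x_i = x'_k, so M intertwines the two diagonal matrices.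
    have hc : M * Matrix.diagonal (fun k ↦ x' k j) = Matrix.diagonal (fun i ↦ x i j) * M := by
      ext i k
      rw [Matrix.mul_diagonal, Matrix.diagonal_mul]
      by_cases hi : x i = x' k
      · rw [hi, mul_comm]
      · simp [M, hv0 k i hi]
    change M * Matrix.diagonal (fun k ↦ x' k j) * M.transpose = Matrix.diagonal fun i ↦ x i j
    rw [hc, Matrix.mul_assoc, hM', Matrix.mul_one]
  change HalfSmash.mk (diagPoint fun i ↦ (x i : Sphere n)) (Sum.inl f) =
    HalfSmash.mk (diagPoint fun i ↦ (x' i : Sphere n)) (Sum.inl f')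
  rw [diagPoint_coe, diagPoint_coe, ← hf, ← hx, ← HalfSmash.mk_conj, OnePoint.map_some]

end Label

/-! ### The homeomorphism -/

section Main

/-- The homeomorphism between two quotients of a space by the same equivalence relation. -/
lemma exists_homeomorph_of_isQuotientMap {Z A B : Type*} [TopologicalSpace Z] [TopologicalSpace A]
    [TopologicalSpace B] {p : Z → A} {q : Z → B} (hp : IsQuotientMap p) (hq : IsQuotientMap q)
    (h : ∀ z w, p z = p w ↔ q z = q w) : ∃ Φ : A ≃ₜ B, ∀ z, Φ (p z) = q z := by
  have hF : ∀ z, q (Function.surjInv hp.surjective (p z)) = q z := fun z ↦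
    (h _ _).1 (Function.surjInv_eq _ _)
  have hG : ∀ z, p (Function.surjInv hq.surjective (q z)) = p z := fun z ↦
    (h _ _).2 (Function.surjInv_eq _ _)
  refine ⟨⟨⟨fun a ↦ q (Function.surjInv hp.surjective a),
    fun b ↦ p (Function.surjInv hq.surjective b), fun a ↦ ?_, fun b ↦ ?_⟩, ?_, ?_⟩, hF⟩
  · exact (hG _).trans (Function.surjInv_eq hp.surjective a)
  · exact (hF _).trans (Function.surjInv_eq hq.surjective b)
  · exact hp.continuous_iff.2 (hq.continuous.congr fun z ↦ (hF z).symm)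
  · exact hq.continuous_iff.2 (hp.continuous.congr fun z ↦ (hG z).symm)

variable {s n : ℕ}

lemma collapseLabel_eq_smashLabel
    (w : (L (EuclideanSpace ℝ (Fin s)) (SymSpace n) × (Fin s → Sphere n)) ⊕ Unit) :
    collapseLabel (lineQuot ∞ s w) = smashLabel (smashQuot n s w) := by
  rcases w with z | u
  · by_cases hz : ∀ i, z.2 i ≠ ∞
    · rw [collapseLabel_inl hz, smashLabel_inl hz]
    · rw [collapseLabel_inl_of_not hz, smashQuot_inl_of_not hz]
      rfl
  · rfl

/-- Every class is either the basepoint, with value `none`, or comes from a frame with all points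
finite, where `smashQuot_eq_of_label` applies. -/
lemma smashLabel_injective : Function.Injective (smashLabel (n := n) (s := s)) := by
  intro a b hab
  obtain ⟨w, rfl⟩ := smashQuot_surjective a
  obtain ⟨w', rfl⟩ := smashQuot_surjective b
  have key : ∀ w : (L (EuclideanSpace ℝ (Fin s)) (SymSpace n) × (Fin s → Sphere n)) ⊕ Unit,
      smashQuot n s w = HalfSmash.base n s ∨ ∃ z, w = Sum.inl z ∧ ∀ i, z.2 i ≠ ∞ := by
    rintro (z | u)
    · by_cases hz : ∀ i, z.2 i ≠ ∞
      · exact Or.inr ⟨z, rfl, hz⟩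
      · exact Or.inl (smashQuot_inl_of_not hz)
    · exact Or.inl rfl
  have hbase : smashLabel (HalfSmash.base n s) = none := rfl
  rcases key w with hw | ⟨z, rfl, hz⟩ <;> rcases key w' with hw' | ⟨z', rfl, hz'⟩
  · rw [hw, hw']
  · rw [hw, hbase, smashLabel_inl hz'] at hab
    exact absurd hab.symm (Option.some_ne_none _)
  · rw [hw', hbase, smashLabel_inl hz] at hab
    exact absurd hab (Option.some_ne_none _)
  · rw [smashLabel_inl hz, smashLabel_inl hz'] at hab
    exact smashQuot_eq_of_label hz hz' (Option.some.inj hab)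

lemma lineQuot_eq_iff_smashQuot_eq
    (w w' : (L (EuclideanSpace ℝ (Fin s)) (SymSpace n) × (Fin s → Sphere n)) ⊕ Unit) :
    lineQuot ∞ s w = lineQuot ∞ s w' ↔ smashQuot n s w = smashQuot n s w' := by
  rw [← collapseLabel_injective.eq_iff, ← smashLabel_injective.eq_iff,
    collapseLabel_eq_smashLabel, collapseLabel_eq_smashLabel]

/-- The action of `Σ_n` on configurations of lines. -/
def linePerm (σ : Equiv.Perm (Fin n))
    (z : L (EuclideanSpace ℝ (Fin s)) (SymSpace n) × (Fin s → Sphere n)) :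
    L (EuclideanSpace ℝ (Fin s)) (SymSpace n) × (Fin s → Sphere n) :=
  (postPerm σ z.1, OnePoint.map (coordPerm σ) ∘ z.2)

lemma smul_lineQuot_inl (σ : Equiv.Perm (Fin n))
    (z : L (EuclideanSpace ℝ (Fin s)) (SymSpace n) × (Fin s → Sphere n)) :
    σ • (lineQuot ∞ s (Sum.inl z) : Subquotient s n) =
      lineQuot ∞ s (Sum.inl (linePerm σ z)) :=
  (lineQuot_eq_mk _ (lineConf_map _ _ _ z).symm _).symm

lemma smul_smashQuot_inl (σ : Equiv.Perm (Fin n))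
    (z : L (EuclideanSpace ℝ (Fin s)) (SymSpace n) × (Fin s → Sphere n)) :
    σ • smashQuot n s (Sum.inl z) = smashQuot n s (Sum.inl (linePerm σ z)) := by
  -- Permuting the coordinates of every eigenvalue vector permutes the corresponding diagonal
  -- matrices in the same way.
  have h : (diagPoint z.2).map (tuplePerm σ) = diagPoint (OnePoint.map (coordPerm σ) ∘ z.2) := by
    by_cases hz : ∀ i, z.2 i ≠ ∞
    · obtain ⟨x, hx⟩ := exists_eq_coe hz
      have h2 : OnePoint.map (coordPerm σ) ∘ (fun i ↦ (x i : Sphere n)) =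
          fun i ↦ ((coordPerm σ (x i) : EuclideanSpace ℝ (Fin n)) : Sphere n) := rfl
      rw [hx, h2, diagPoint_coe, diagPoint_coe]
      rfl
    · rw [diagPoint_of_not hz, diagPoint_of_not, OnePoint.map_infty]
      refine fun h ↦ hz fun i hi ↦ h i ?_
      rw [Function.comp_apply, hi, OnePoint.map_infty]
  change HalfSmash.mk ((diagPoint z.2).map (tuplePerm σ)) _ = HalfSmash.mk (diagPoint _) _
  rw [h]
  rfl

end Main

end KO

end

theorem theorem6p2 (s n : ℕ) (hn : 0 < n) :
    ∃ Φ : KO.Subquotient s n ≃ₜ KO.HalfSmash n s,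
      Φ (KO.Subquotient.base s n) = KO.HalfSmash.base n s ∧
      ∀ (σ : Equiv.Perm (Fin n)) (z : KO.Subquotient s n), Φ (σ • z) = σ • Φ z := by
  obtain ⟨Φ, hΦ⟩ := KO.exists_homeomorph_of_isQuotientMap
    (KO.isQuotientMap_lineQuot (U := KO.SymSpace n) (pt := (∞ : KO.Sphere n)) s)
    (KO.isQuotientMap_smashQuot (n := n) (s := s)) KO.lineQuot_eq_iff_smashQuot_eq
  refine ⟨Φ, hΦ (Sum.inr ()), fun σ z ↦ ?_⟩
  -- Equivariance is checked on representatives in Z, where both actions are induced by `linePerm`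
  -- and fix the extra point.
  obtain ⟨z | u, rfl⟩ := KO.lineQuot_surjective s z
  · rw [KO.smul_lineQuot_inl, hΦ, hΦ, KO.smul_smashQuot_inl]
  · have h1 : σ • (KO.lineQuot ∞ s (Sum.inr u) : KO.Subquotient s n) =
        KO.lineQuot ∞ s (Sum.inr u) := rfl
    rw [h1, hΦ]
    rfl
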